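/- Let $(W,S)$ be a Coxeter system of finite rank, with Coxeter matrix $(m_{st})$, and let $V$ be a finite-dimensional complex vector space with a realization of $(W,S)$: simple roots $\alpha_s\in V^*$ and coroots $\alpha_s^\vee\in V$ for $s\in S$ with $\langle\alpha_s^\vee,\alpha_s\rangle=2$, such that $s(v)=v-\langle v,\alpha_s\rangle\alpha_s^\vee$ defines a representation of $W$ on $V$, and such that for $s\ne t$ with $m_{st}<\infty$ the two-coloured quantum number $[m_{st}]$ at $x=-\langle\alpha_s^\vee,\alpha_t\rangle$, $y=-\langle\alpha_t^\vee,\alpha_s\rangle$ vanishes; here $[0]_{x,y}=0$, $[1]_{x,y}=1$, $[k+2]_{x,y}=x[k+1]_{y,x}-[k]_{x,y}$. Assume that the realization is balanced ($[m_{st}-1]=1$ for all $s\neq t$ with $m_{st}<\infty$) and reflection faithful ($W$ acts faithfully on $V$, and the fixed space of $w\in W$ has codimension $1$ if and only if $w$ is conjugate to an element of $S$). Let $R=\operatorname{Sym}(V^*)$, graded with $V^*$ in degree $2$, and put $B_s=R\otimes_{R^s}R(1)$. Let $\mathrm{SBim}(W)$ be the monoidal category of Soergel bimodules: its objects form the smallest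 class of graded $(R,R)$-bimodules that contains $R$ and all $B_s$ and is closed under $\star=\otimes_R$, grading shifts, isomorphisms, finite direct sums and direct summands; its morphisms are the bimodule maps of all degrees. For a $\mathbb C$-linear category $\mathcal C$ let $\mathrm{HH}_0(\mathcal C)=\bigoplus_X\operatorname{End}(X)/\operatorname{span}\{gf-fg\}$, with $[f]$ the class of an endomorphism $f$. For a $\mathbb C$-linear monoidal category $\mathcal C$ with unit $\mathbb 1$ let $\operatorname{Tr}_0(\mathcal C)$ be its horizontal trace. Its objects $\operatorname{Tr}_0(X)$ correspond to the objects $X$ of $\mathcal C$. The space $\operatorname{Hom}(\operatorname{Tr}_0(X),\operatorname{Tr}_0(X'))$ is the quotient of $\bigoplus_Y\operatorname{Hom}(X\star Y,Y\star X')$ by the relations $(c\star\mathrm{Id}_{X'})\circ f\sim f\circ(\mathrm{Id}_X\star c)$ for $c\colon Y\to Y'$ and $f\colon X\star Y'\to Y\star X'$. The composite of the classes of $g\colon X\star Y\to Y\star X'$ and then $f\colon X'\star Y'\to Y'\star X''$ is the class of $(\mathrm{Id}_Y\star f)\circ(g\star\mathrm{Id}_{Y'})$. The unitors identify $\mathrm{HH}_0(\mathcal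 C)\cong\operatorname{End}(\operatorname{Tr}_0(\mathbb 1))$. Let $I\subset S$ be such that the parabolic subgroup $W_I=\langle I\rangle$ is finite, let $R^I\subset R$ be the ring of $W_I$-invariants, and let $B_I=R\otimes_{R^I}R$. Then $B_I$ is a Soergel bimodule; under the identification above, $\frac{[\mathrm{Id}_{B_I}]}{|W_I|}$ is an idempotent endomorphism of $\operatorname{Tr}_0(\mathbb 1)$; and in the Karoubi completion $\operatorname{Kar}\operatorname{Tr}_0(\mathrm{SBim}(W))$ the direct sum below exists and there is an isomorphism $$\operatorname{Tr}_0(B_I)\;\cong\;\bigoplus_{|W_I|}\left(\operatorname{Tr}_0(\mathbb 1),\ \frac{[\mathrm{Id}_{B_I}]}{|W_I|}\right).$$ -/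

import Mathlib

open CategoryTheory MonoidalCategory CategoryTheory.Limits
open scoped TensorProduct


noncomputable section

/-! ### Horizontal and vertical traces of a `ℂ`-linear monoidal category -/

/-- The objects of the (underived) horizontal trace of `C` are the objects of `C`. -/
structure Tr0 (C : Type*) where
  /-- the object `Tr₀(X)` attached to `X` -/
  of ::
  /-- the underlying object -/
  obj : C

namespace Tr0

universe v u

section
variable {C : Type u} [Category.{v} C] [MonoidalCategory C] [Preadditive C] [Linear ℂ C]

/-- `⨁_Y Hom(X ⋆ Y, Y ⋆ X')`. -/
abbrev PreHom (X X' : C) : Type (max u v) := DirectSum C fun Y => (X ⊗ Y ⟶ Y ⊗ X')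

open Classical in
/-- The inclusion of the `Y`-th summand. -/
def incl (X X' Y : C) : (X ⊗ Y ⟶ Y ⊗ X') →ₗ[ℂ] PreHom X X' :=
  DirectSum.lof ℂ C (fun Y => (X ⊗ Y ⟶ Y ⊗ X')) Y

/-- The relations `(c ⋆ Id) ∘ f ∼ f ∘ (Id ⋆ c)` for `c : Y ⟶ Y'` and `f : X ⋆ Y' ⟶ Y ⋆ X'`. -/
def homRel (X X' : C) : Submodule ℂ (PreHom X X') :=
  Submodule.span ℂ {z | ∃ (Y Y' : C) (c : Y ⟶ Y') (f : X ⊗ Y' ⟶ Y ⊗ X'),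
    z = incl X X' Y' (f ≫ c ▷ X') - incl X X' Y (X ◁ c ≫ f)}

/-- Morphisms `Tr₀(X) ⟶ Tr₀(X')`: the coend of `Hom(X ⋆ Y, Y ⋆ X')` over `Y`. -/
abbrev HomSpace (X X' : C) : Type (max u v) := PreHom X X' ⧸ homRel X X'

/-- The class in the horizontal trace of a map `X ⋆ Y ⟶ Y ⋆ X'`. -/
def cls (X X' Y : C) : (X ⊗ Y ⟶ Y ⊗ X') →ₗ[ℂ] HomSpace X X' :=
  (homRel X X').mkQ ∘ₗ incl X X' Y

theorem cls_rel {X X' Y Y' : C} (c : Y ⟶ Y') (f : X ⊗ Y' ⟶ Y ⊗ X') :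
    cls X X' Y' (f ≫ c ▷ X') = cls X X' Y (X ◁ c ≫ f) := by
  rw [← sub_eq_zero]
  simp only [cls, LinearMap.comp_apply, ← map_sub]
  exact (Submodule.Quotient.mk_eq_zero _).2 (Submodule.subset_span ⟨Y, Y', c, f, rfl⟩)

/-- The universal property of the coend. -/
def desc {X X' : C} {N : Type*} [AddCommGroup N] [Module ℂ N]
    (φ : ∀ Y, (X ⊗ Y ⟶ Y ⊗ X') →ₗ[ℂ] N)
    (h : ∀ (Y Y' : C) (c : Y ⟶ Y') (f : X ⊗ Y' ⟶ Y ⊗ X'),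
      φ Y' (f ≫ c ▷ X') = φ Y (X ◁ c ≫ f)) : HomSpace X X' →ₗ[ℂ] N := by
  classical
  refine (homRel X X').liftQ (DirectSum.toModule ℂ C N φ) ?_
  rw [homRel, Submodule.span_le]
  rintro _ ⟨Y, Y', c, f, rfl⟩
  have e : ∀ Y g, DirectSum.toModule ℂ C N φ (incl X X' Y g) = φ Y g := fun Y g => by
    simp only [incl]
    convert DirectSum.toModule_lof (R := ℂ) (φ := φ) Y g
  simp only [SetLike.mem_coe, LinearMap.mem_ker, map_sub, e, h, sub_self]

@[simp] theorem desc_cls {X X' : C} {N : Type*} [AddCommGroup N] [Module ℂ N]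
    (φ : ∀ Y, (X ⊗ Y ⟶ Y ⊗ X') →ₗ[ℂ] N)
    (h : ∀ (Y Y' : C) (c : Y ⟶ Y') (f : X ⊗ Y' ⟶ Y ⊗ X'),
      φ Y' (f ≫ c ▷ X') = φ Y (X ◁ c ≫ f)) (Y : C) (f : X ⊗ Y ⟶ Y ⊗ X') :
    desc φ h (cls X X' Y f) = φ Y f := by
  classical
  simp only [desc, cls, LinearMap.comp_apply, Submodule.mkQ_apply, Submodule.liftQ_apply, incl]
  convert DirectSum.toModule_lof (R := ℂ) (φ := φ) Y f

open Classical in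
theorem hom_ext {X X' : C} {N : Type*} [AddCommGroup N] [Module ℂ N]
    {φ ψ : HomSpace X X' →ₗ[ℂ] N} (h : ∀ Y f, φ (cls X X' Y f) = ψ (cls X X' Y f)) : φ = ψ := by
  exact Submodule.linearMap_qext _ (DirectSum.linearMap_ext ℂ fun Y => LinearMap.ext fun f => h Y f)

variable [MonoidalPreadditive C] [MonoidalLinear ℂ C]

/-- The composite `X ⋆ (Y ⋆ Y') ⟶ (Y ⋆ X') ⋆ Y' ⟶ (Y ⋆ Y') ⋆ X''`
of `g : X ⋆ Y ⟶ Y ⋆ X'` and `f : X' ⋆ Y' ⟶ Y' ⋆ X''`. -/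
def compMap (X X' X'' Y Y' : C) :
    (X ⊗ Y ⟶ Y ⊗ X') →ₗ[ℂ] (X' ⊗ Y' ⟶ Y' ⊗ X'') →ₗ[ℂ]
      (X ⊗ (Y ⊗ Y') ⟶ (Y ⊗ Y') ⊗ X'') :=
  LinearMap.mk₂ ℂ
    (fun g f => (α_ X Y Y').inv ≫ g ▷ Y' ≫ (α_ Y X' Y').hom ≫ Y ◁ f ≫ (α_ Y Y' X'').inv)
    (by intros; simp) (by intros; simp) (by intros; simp) (by intros; simp)

/-- Composition in the horizontal trace. -/
def comp (X X' X'' : C) :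
    HomSpace X X' →ₗ[ℂ] HomSpace X' X'' →ₗ[ℂ] HomSpace X X'' :=
  desc (fun Y => (desc (fun Y' => LinearMap.flip
      (LinearMap.compr₂ (compMap X X' X'' Y Y') (cls X X'' (Y ⊗ Y')))) (by
      intro Z Z' c f
      ext g
      simp only [compMap, LinearMap.flip_apply, LinearMap.compr₂_apply, LinearMap.mk₂_apply]
      have := cls_rel (X := X) (X' := X'') (Y ◁ c)
        ((α_ X Y Z').inv ≫ g ▷ Z' ≫ (α_ Y X' Z').hom ≫ Y ◁ f ≫ (α_ Y Z X'').inv)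
      convert this using 2
      · simp
      · simp only [whiskerLeft_comp, Category.assoc]
        rw [← associator_naturality_right_assoc, ← whisker_exchange_assoc,
          associator_inv_naturality_right_assoc])).flip)
    (by
      intro Z Z' c g
      refine hom_ext fun Y f => ?_
      simp only [LinearMap.flip_apply, desc_cls, compMap, LinearMap.compr₂_apply,
        LinearMap.mk₂_apply]
      have := cls_rel (X := X) (X' := X'') (c ▷ Y)
        ((α_ X Z' Y).inv ≫ g ▷ Y ≫ (α_ Z X' Y).hom ≫ Z ◁ f ≫ (α_ Z Y X'').inv)
      convert this using 2
      · simp only [comp_whiskerRight, Category.assoc, associator_naturality_left_assoc]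
        rw [← whisker_exchange_assoc, associator_inv_naturality_left]
      · simp)

@[simp] theorem comp_cls (X X' X'' Y Y' : C) (g : X ⊗ Y ⟶ Y ⊗ X') (f : X' ⊗ Y' ⟶ Y' ⊗ X'') :
    comp X X' X'' (cls X X' Y g) (cls X' X'' Y' f) =
      cls X X'' (Y ⊗ Y')
        ((α_ X Y Y').inv ≫ g ▷ Y' ≫ (α_ Y X' Y').hom ≫ Y ◁ f ≫ (α_ Y Y' X'').inv) := by
  simp [comp, compMap]

/-- The identity of `Tr₀(X)` is the class of the canonical map `X ⋆ 𝟙 ⟶ 𝟙 ⋆ X`. -/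
def idCls (X : C) : HomSpace X X := cls X X (𝟙_ C) ((ρ_ X).hom ≫ (λ_ X).inv)

theorem id_comp' (X X' : C) : comp X X X' (idCls X) = LinearMap.id := by
  refine hom_ext fun Y f => ?_
  simp only [idCls, comp_cls, LinearMap.id_apply]
  have := cls_rel (X := X) (X' := X') (λ_ Y).inv (f := X ◁ (λ_ Y).hom ≫ f)
  convert this using 2
  · simp
  · simp

theorem comp_id' (X X' : C) : (comp X X' X').flip (idCls X') = LinearMap.id := by
  refine hom_ext fun Y f => ?_
  simp only [idCls, comp_cls, LinearMap.id_apply, LinearMap.flip_apply]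
  have := cls_rel (X := X) (X' := X') (ρ_ Y).inv (f := X ◁ (ρ_ Y).hom ≫ f)
  convert this using 2
  · simp
  · simp

theorem assoc' (X₁ X₂ X₃ X₄ : C) (a : HomSpace X₁ X₂) (b : HomSpace X₂ X₃)
    (c : HomSpace X₃ X₄) :
    comp X₁ X₃ X₄ (comp X₁ X₂ X₃ a b) c = comp X₁ X₂ X₄ a (comp X₂ X₃ X₄ b c) := by
  have key : LinearMap.compr₂ (comp X₁ X₂ X₃) (comp X₁ X₃ X₄) =
      ((LinearMap.llcomp ℂ _ _ _).flip ∘ₗ comp X₂ X₃ X₄).flip ∘ₗ comp X₁ X₂ X₄ := by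
    refine hom_ext fun Y f => hom_ext fun Z g => hom_ext fun T h => ?_
    simp only [LinearMap.compr₂_apply, LinearMap.comp_apply, LinearMap.flip_apply,
      LinearMap.llcomp_apply, comp_cls]
    have := cls_rel (X := X₁) (X' := X₄) (α_ Y Z T).inv
      (f := X₁ ◁ (α_ Y Z T).hom ≫ (α_ X₁ Y (Z ⊗ T)).inv ≫ f ▷ (Z ⊗ T) ≫
        (α_ Y X₂ (Z ⊗ T)).hom ≫ Y ◁ ((α_ X₂ Z T).inv ≫ g ▷ T ≫ (α_ Z X₃ T).hom ≫
          Z ◁ h ≫ (α_ Z T X₄).inv) ≫ (α_ Y (Z ⊗ T) X₄).inv)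
    convert this using 2
    · simp
    · simp
  exact congr($key a b c)

end

section
variable (C : Type u) [Category.{v} C] [MonoidalCategory C] [Preadditive C] [Linear ℂ C]
variable [MonoidalPreadditive C] [MonoidalLinear ℂ C]

/-- The horizontal trace as a category. -/
instance : Category.{max u v} (Tr0 C) where
  Hom X Y := HomSpace X.obj Y.obj
  id X := idCls X.obj
  comp f g := comp _ _ _ f g
  id_comp f := congr($(id_comp' _ _) f)
  comp_id f := congr($(comp_id' _ _) f)
  assoc f g h := assoc' _ _ _ _ f g h

instance : Preadditive (Tr0 C) where
  homGroup X Y := inferInstanceAs (AddCommGroup (HomSpace X.obj Y.obj))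
  add_comp _ _ _ f f' g := (comp _ _ _).map_add₂ f f' g
  comp_add _ _ _ f g g' := (comp _ _ _ f).map_add g g'

instance : Linear ℂ (Tr0 C) where
  homModule X Y := inferInstanceAs (Module ℂ (HomSpace X.obj Y.obj))
  smul_comp _ _ _ r f g := (comp _ _ _).map_smul₂ r f g
  comp_smul _ _ _ f r g := (comp _ _ _ f).map_smul r g
end

end Tr0

namespace HH0

universe v u

section
variable (C : Type u) [Category.{v} C] [Preadditive C] [Linear ℂ C]

/-- `⨁_X End(X)`. -/
abbrev Pre : Type (max u v) := DirectSum C fun X => (X ⟶ X)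

variable {C} in
open Classical in
/-- The inclusion of the `X`-th summand. -/
def incl (X : C) : (X ⟶ X) →ₗ[ℂ] Pre C := DirectSum.lof ℂ C (fun X => (X ⟶ X)) X

/-- The span of the differences `g₀ ∘ g₁ - g₁ ∘ g₀`. -/
def commutators : Submodule ℂ (Pre C) :=
  Submodule.span ℂ {z | ∃ (X Y : C) (f : X ⟶ Y) (g : Y ⟶ X), z = incl X (f ≫ g) - incl Y (g ≫ f)}

end
end HH0

universe v u

section
variable (C : Type u) [Category.{v} C] [Preadditive C] [Linear ℂ C]

/-- The vertical trace `HH₀(C) = ⨁_X End(X) / span (g₀ g₁ - g₁ g₀)`. -/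
abbrev HH0 : Type (max u v) := HH0.Pre C ⧸ HH0.commutators C

end

namespace HH0
section
variable {C : Type u} [Category.{v} C] [Preadditive C] [Linear ℂ C]

/-- The class `[f]` of an endomorphism `f`. -/
def cls (X : C) : (X ⟶ X) →ₗ[ℂ] HH0 C := (commutators C).mkQ ∘ₗ incl X

theorem cls_comm {X Y : C} (f : X ⟶ Y) (g : Y ⟶ X) : cls X (f ≫ g) = cls Y (g ≫ f) := by
  rw [← sub_eq_zero]
  simp only [cls, LinearMap.comp_apply, ← map_sub]
  exact (Submodule.Quotient.mk_eq_zero _).2 (Submodule.subset_span ⟨X, Y, f, g, rfl⟩)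

/-- The universal property of `HH₀`. -/
def desc {N : Type*} [AddCommGroup N] [Module ℂ N] (φ : ∀ X : C, (X ⟶ X) →ₗ[ℂ] N)
    (h : ∀ (X Y : C) (f : X ⟶ Y) (g : Y ⟶ X), φ X (f ≫ g) = φ Y (g ≫ f)) : HH0 C →ₗ[ℂ] N := by
  classical
  refine (commutators C).liftQ (DirectSum.toModule ℂ C N φ) ?_
  rw [commutators, Submodule.span_le]
  rintro _ ⟨X, Y, f, g, rfl⟩
  have e : ∀ Y g, DirectSum.toModule ℂ C N φ (incl Y g) = φ Y g := fun Y g => by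
    simp only [incl]
    convert DirectSum.toModule_lof (R := ℂ) (φ := φ) Y g
  simp only [SetLike.mem_coe, LinearMap.mem_ker, map_sub, e, h X Y, sub_self]

@[simp] theorem desc_cls {N : Type*} [AddCommGroup N] [Module ℂ N]
    (φ : ∀ X : C, (X ⟶ X) →ₗ[ℂ] N)
    (h : ∀ (X Y : C) (f : X ⟶ Y) (g : Y ⟶ X), φ X (f ≫ g) = φ Y (g ≫ f)) (X : C) (f : X ⟶ X) :
    desc φ h (cls X f) = φ X f := by
  classical
  simp only [desc, cls, LinearMap.comp_apply, Submodule.mkQ_apply, Submodule.liftQ_apply, incl]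
  convert DirectSum.toModule_lof (R := ℂ) (φ := φ) X f

open Classical in
theorem hom_ext {N : Type*} [AddCommGroup N] [Module ℂ N]
    {φ ψ : HH0 C →ₗ[ℂ] N} (h : ∀ X f, φ (cls X f) = ψ (cls X f)) : φ = ψ := by
  exact Submodule.linearMap_qext _ (DirectSum.linearMap_ext ℂ fun Y => LinearMap.ext fun f => h Y f)

end

section
variable (C : Type u) [Category.{v} C] [MonoidalCategory C] [Preadditive C] [Linear ℂ C]
variable [MonoidalPreadditive C] [MonoidalLinear ℂ C]

/-- The map `HH₀(C) ⟶ End(Tr₀(𝟙))` induced by the unitors `Hom(Y, Y) ≅ Hom(𝟙 ⋆ Y, Y ⋆ 𝟙)`. -/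
def toEnd : HH0 C →ₗ[ℂ] Tr0.HomSpace (𝟙_ C) (𝟙_ C) :=
  desc (fun Y => Tr0.cls (𝟙_ C) (𝟙_ C) Y ∘ₗ
    Linear.leftComp ℂ _ (λ_ Y).hom ∘ₗ Linear.rightComp ℂ _ (ρ_ Y).inv) (by
      intro X Y f g
      have := Tr0.cls_rel (X := 𝟙_ C) (X' := 𝟙_ C) g ((λ_ X).hom ≫ f ≫ (ρ_ Y).inv)
      simpa using this)

/-- The inverse of `toEnd`. -/
def ofEnd : Tr0.HomSpace (𝟙_ C) (𝟙_ C) →ₗ[ℂ] HH0 C :=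
  Tr0.desc (fun Y => cls Y ∘ₗ
    Linear.leftComp ℂ _ (λ_ Y).inv ∘ₗ Linear.rightComp ℂ _ (ρ_ Y).hom) (by
      intro Y Y' c f
      have := cls_comm ((λ_ Y').inv ≫ f ≫ (ρ_ Y).hom) c
      simpa using this)

/-- The identification `HH₀(C) ≅ End(Tr₀(𝟙))`, induced by the unitors. -/
def equivEnd : HH0 C ≃ₗ[ℂ] (Tr0.of (𝟙_ C) ⟶ Tr0.of (𝟙_ C)) :=
  LinearEquiv.ofLinearMap (M₂ := Tr0.HomSpace (𝟙_ C) (𝟙_ C)) (toEnd C) (ofEnd C)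
    (Tr0.hom_ext fun Y f => by simp [toEnd, ofEnd])
    (hom_ext fun Y f => by simp [toEnd, ofEnd])

theorem equivEnd_cls (X : C) (f : X ⟶ X) :
    equivEnd C (cls X f) = Tr0.cls (𝟙_ C) (𝟙_ C) X ((λ_ X).hom ≫ f ≫ (ρ_ X).inv) := by
  change toEnd C (cls X f) = _
  simp [toEnd]

end
end HH0

end

noncomputable section
universe u

/-! ### Graded bimodules over a commutative `ℂ`-algebra -/

/-- An `R`-`R`-bimodule (on which `ℂ` acts centrally) with a family of subspaces, its graded pieces.
That the pieces form a grading is not recorded here: it holds for all the Soergel bimodules below. -/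
structure GrBimod {R : Type u} [CommRing R] [Algebra ℂ R] (𝒜 : ℤ → Submodule ℂ R) where
  /-- the underlying set -/
  carrier : Type u
  [addCommGroup : AddCommGroup carrier]
  [module : Module ℂ carrier]
  /-- the left action -/
  left : R →ₐ[ℂ] Module.End ℂ carrier
  /-- the right action (`R` is commutative) -/
  right : R →ₐ[ℂ] Module.End ℂ carrier
  left_right : ∀ a b m, left a (right b m) = right b (left a m)
  /-- the graded pieces -/
  gr : ℤ → Submodule ℂ carrier

namespace GrBimod

attribute [instance] addCommGroup module

variable {R : Type u} [CommRing R] [Algebra ℂ R] {𝒜 : ℤ → Submodule ℂ R}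

/-- The space of all bimodule maps `M ⟶ N`. Maps of every degree are allowed, so that for example
`End(R) = R`; since Soergel bimodules are finitely generated, every bimodule map between them is a
finite sum of homogeneous ones. -/
def homs (M N : GrBimod 𝒜) : Submodule ℂ (M.carrier →ₗ[ℂ] N.carrier) where
  carrier := {f | (∀ a m, f (M.left a m) = N.left a (f m)) ∧
    ∀ a m, f (M.right a m) = N.right a (f m)}
  zero_mem' := by simp
  add_mem' hf hg := ⟨by simp [hf.1, hg.1], by simp [hf.2, hg.2]⟩
  smul_mem' c f hf := ⟨by simp [hf.1], by simp [hf.2]⟩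

instance : Category (GrBimod 𝒜) where
  Hom M N := homs M N
  id M := ⟨LinearMap.id, by simp [homs]⟩
  comp f g := ⟨g.1 ∘ₗ f.1, by simp [f.2.1, g.2.1], by simp [f.2.2, g.2.2]⟩

/-- The linear map underlying a morphism. -/
def Hom.lin {M N : GrBimod 𝒜} (f : M ⟶ N) : M.carrier →ₗ[ℂ] N.carrier := f.1

/-- Build a morphism from a linear map. -/
def Hom.mk {M N : GrBimod 𝒜} (f : M.carrier →ₗ[ℂ] N.carrier)
    (hl : ∀ a m, f (M.left a m) = N.left a (f m))
    (hr : ∀ a m, f (M.right a m) = N.right a (f m)) : M ⟶ N := ⟨f, hl, hr⟩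

@[simp] theorem lin_mk {M N : GrBimod 𝒜} (f : M.carrier →ₗ[ℂ] N.carrier) (hl hr) :
    Hom.lin (Hom.mk (M := M) (N := N) f hl hr) = f := rfl
@[simp] theorem lin_id (M : GrBimod 𝒜) : Hom.lin (𝟙 M) = LinearMap.id := rfl
@[simp] theorem lin_comp {M N P : GrBimod 𝒜} (f : M ⟶ N) (g : N ⟶ P) :
    Hom.lin (f ≫ g) = Hom.lin g ∘ₗ Hom.lin f := rfl
theorem lin_left {M N : GrBimod 𝒜} (f : M ⟶ N) (a : R) (m : M.carrier) :
    Hom.lin f (M.left a m) = N.left a (Hom.lin f m) := f.2.1 a m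
theorem lin_right {M N : GrBimod 𝒜} (f : M ⟶ N) (a : R) (m : M.carrier) :
    Hom.lin f (M.right a m) = N.right a (Hom.lin f m) := f.2.2 a m
theorem hom_ext {M N : GrBimod 𝒜} {f g : M ⟶ N} (h : Hom.lin f = Hom.lin g) : f = g :=
  Subtype.ext h

instance : Preadditive (GrBimod 𝒜) where
  homGroup M N := inferInstanceAs (AddCommGroup (homs M N))
  add_comp _ _ _ f f' g := Subtype.ext (LinearMap.comp_add f.1 f'.1 g.1)
  comp_add _ _ _ f g g' := Subtype.ext (LinearMap.add_comp f.1 g'.1 g.1)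

instance : Linear ℂ (GrBimod 𝒜) where
  homModule M N := inferInstanceAs (Module ℂ (homs M N))
  smul_comp _ _ _ r f g := Subtype.ext (LinearMap.comp_smul g.1 r f.1)
  comp_smul _ _ _ f r g := Subtype.ext (LinearMap.smul_comp r g.1 f.1)

@[simp] theorem lin_add {M N : GrBimod 𝒜} (f g : M ⟶ N) :
    Hom.lin (f + g) = Hom.lin f + Hom.lin g := rfl
@[simp] theorem lin_smul {M N : GrBimod 𝒜} (c : ℂ) (f : M ⟶ N) :
    Hom.lin (c • f) = c • Hom.lin f := rfl

section tensor

/-- The relations `(m · r) ⊗ n = m ⊗ (r · n)` which cut `M ⊗_R N` out of `M ⊗_ℂ N`. -/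
def tensorRel (M N : GrBimod 𝒜) : Submodule ℂ (M.carrier ⊗[ℂ] N.carrier) :=
  Submodule.span ℂ {x | ∃ r m n, x = M.right r m ⊗ₜ[ℂ] n - m ⊗ₜ[ℂ] N.left r n}

/-- The tensor product `M ⊗_R N`. -/
abbrev Tensor (M N : GrBimod 𝒜) : Type u := (M.carrier ⊗[ℂ] N.carrier) ⧸ tensorRel M N

/-- The class of `m ⊗ n` in `M ⊗_R N`. -/
def preMk (M N : GrBimod 𝒜) : M.carrier →ₗ[ℂ] N.carrier →ₗ[ℂ] Tensor M N :=
  (TensorProduct.mk ℂ M.carrier N.carrier).compr₂ (tensorRel M N).mkQ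

theorem preMk_rel (M N : GrBimod 𝒜) (r : R) (m : M.carrier) (n : N.carrier) :
    preMk M N (M.right r m) n = preMk M N m (N.left r n) := by
  rw [← sub_eq_zero]
  simp only [preMk, LinearMap.compr₂_apply, ← map_sub]
  exact (Submodule.Quotient.mk_eq_zero _).2 (Submodule.subset_span ⟨r, m, n, rfl⟩)

/-- The universal property of `M ⊗_R N`. -/
def preLift {M N : GrBimod 𝒜} {P : Type*} [AddCommGroup P] [Module ℂ P]
    (φ : M.carrier →ₗ[ℂ] N.carrier →ₗ[ℂ] P)
    (h : ∀ r m n, φ (M.right r m) n = φ m (N.left r n)) : Tensor M N →ₗ[ℂ] P :=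
  (tensorRel M N).liftQ (TensorProduct.lift φ) (by
    rw [tensorRel, Submodule.span_le]
    rintro _ ⟨r, m, n, rfl⟩
    simp [h])

@[simp] theorem preLift_preMk {M N : GrBimod 𝒜} {P : Type*} [AddCommGroup P] [Module ℂ P]
    (φ : M.carrier →ₗ[ℂ] N.carrier →ₗ[ℂ] P) (h : ∀ r m n, φ (M.right r m) n = φ m (N.left r n))
    (m : M.carrier) (n : N.carrier) : preLift φ h (preMk M N m n) = φ m n := by
  simp [preLift, preMk]

theorem preExt {M N : GrBimod 𝒜} {P : Type*} [AddCommGroup P] [Module ℂ P]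
    {f g : Tensor M N →ₗ[ℂ] P} (h : ∀ m n, f (preMk M N m n) = g (preMk M N m n)) : f = g :=
  Submodule.linearMap_qext _ (TensorProduct.ext' h)

/-- The map `f ⊗ g` on `M ⊗_R N`, for `f` right linear and `g` left linear. -/
def preMap {M N M' N' : GrBimod 𝒜} (f : M.carrier →ₗ[ℂ] M'.carrier)
    (g : N.carrier →ₗ[ℂ] N'.carrier)
    (hf : ∀ a m, f (M.right a m) = M'.right a (f m))
    (hg : ∀ a n, g (N.left a n) = N'.left a (g n)) : Tensor M N →ₗ[ℂ] Tensor M' N' :=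
  preLift ((preMk M' N').compl₁₂ f g) (by intro r m n; simp [hf, hg, preMk_rel])

@[simp] theorem preMap_preMk {M N M' N' : GrBimod 𝒜} (f : M.carrier →ₗ[ℂ] M'.carrier)
    (g : N.carrier →ₗ[ℂ] N'.carrier) (hf hg) (m : M.carrier) (n : N.carrier) :
    preMap (M := M) (N := N) (M' := M') (N' := N') f g hf hg (preMk M N m n) =
      preMk M' N' (f m) (g n) := by
  simp [preMap]

/-- The left action on `M ⊗_R N`. -/
def tensorL (M N : GrBimod 𝒜) : R →ₐ[ℂ] Module.End ℂ (Tensor M N) :=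
  let φ (a : R) : Module.End ℂ (Tensor M N) :=
    preMap (M.left a) LinearMap.id (M.left_right a) (fun _ _ => rfl)
  have h (a m n) : φ a (preMk M N m n) = preMk M N (M.left a m) n := by simp [φ]
  AlgHom.ofLinearMap
    { toFun := φ
      map_add' := fun a b => preExt fun m n => by simp [h]
      map_smul' := fun c a => preExt fun m n => by simp [h] }
    (preExt fun m n => by simp [h]) (fun a b => preExt fun m n => by simp [h])

/-- The right action on `M ⊗_R N`. -/
def tensorR (M N : GrBimod 𝒜) : R →ₐ[ℂ] Module.End ℂ (Tensor M N) :=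
  let φ (a : R) : Module.End ℂ (Tensor M N) :=
    preMap LinearMap.id (N.right a) (fun _ _ => rfl) (fun b n => (N.left_right b a n).symm)
  have h (a m n) : φ a (preMk M N m n) = preMk M N m (N.right a n) := by simp [φ]
  AlgHom.ofLinearMap
    { toFun := φ
      map_add' := fun a b => preExt fun m n => by simp [h]
      map_smul' := fun c a => preExt fun m n => by simp [h] }
    (preExt fun m n => by simp [h]) (fun a b => preExt fun m n => by simp [h])

@[simp] theorem tensorL_preMk (M N : GrBimod 𝒜) (a : R) (m : M.carrier) (n : N.carrier) :
    tensorL M N a (preMk M N m n) = preMk M N (M.left a m) n :=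
  preMap_preMk (M.left a) LinearMap.id (M.left_right a) (fun _ _ => rfl) m n

@[simp] theorem tensorR_preMk (M N : GrBimod 𝒜) (a : R) (m : M.carrier) (n : N.carrier) :
    tensorR M N a (preMk M N m n) = preMk M N m (N.right a n) :=
  preMap_preMk LinearMap.id (N.right a) (fun _ _ => rfl) (fun b n => (N.left_right b a n).symm) m n

/-- The tensor product `M ⊗_R N` as a graded bimodule, with `deg (m ⊗ n) = deg m + deg n`. -/
def tensor (M N : GrBimod 𝒜) : GrBimod 𝒜 where
  carrier := Tensor M N
  left := tensorL M N
  right := tensorR M N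
  left_right a b := LinearMap.congr_fun
    (f := tensorL M N a ∘ₗ tensorR M N b) (g := tensorR M N b ∘ₗ tensorL M N a)
    (preExt fun m n => by simp)
  gr i := Submodule.span ℂ {x | ∃ j k, j + k = i ∧ ∃ m ∈ M.gr j, ∃ n ∈ N.gr k, x = preMk M N m n}

/-- The class of `m ⊗ n` in `M ⊗_R N`. -/
def tmul (M N : GrBimod 𝒜) : M.carrier →ₗ[ℂ] N.carrier →ₗ[ℂ] (tensor M N).carrier := preMk M N

theorem tmul_rel {M N : GrBimod 𝒜} (r : R) (m : M.carrier) (n : N.carrier) :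
    tmul M N (M.right r m) n = tmul M N m (N.left r n) := preMk_rel M N r m n

/-- The universal property of `M ⊗_R N`. -/
def lift {M N : GrBimod 𝒜} {P : Type*} [AddCommGroup P] [Module ℂ P]
    (φ : M.carrier →ₗ[ℂ] N.carrier →ₗ[ℂ] P)
    (h : ∀ r m n, φ (M.right r m) n = φ m (N.left r n)) : (tensor M N).carrier →ₗ[ℂ] P :=
  preLift φ h

@[simp] theorem lift_tmul {M N : GrBimod 𝒜} {P : Type*} [AddCommGroup P] [Module ℂ P]
    (φ : M.carrier →ₗ[ℂ] N.carrier →ₗ[ℂ] P) (h : ∀ r m n, φ (M.right r m) n = φ m (N.left r n))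
    (m : M.carrier) (n : N.carrier) : lift φ h (tmul M N m n) = φ m n :=
  preLift_preMk φ h m n

theorem lin_ext {M N : GrBimod 𝒜} {P : Type*} [AddCommGroup P] [Module ℂ P]
    {f g : (tensor M N).carrier →ₗ[ℂ] P} (h : ∀ m n, f (tmul M N m n) = g (tmul M N m n)) :
    f = g := preExt h

@[simp] theorem left_tmul (M N : GrBimod 𝒜) (a : R) (m : M.carrier) (n : N.carrier) :
    (tensor M N).left a (tmul M N m n) = tmul M N (M.left a m) n := tensorL_preMk M N a m n

@[simp] theorem right_tmul (M N : GrBimod 𝒜) (a : R) (m : M.carrier) (n : N.carrier) :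
    (tensor M N).right a (tmul M N m n) = tmul M N m (N.right a n) := tensorR_preMk M N a m n

/-- A linear map out of `M ⊗_R N` is a bimodule map if it is one on pure tensors. -/
def Hom.mkT {M N P : GrBimod 𝒜} (f : (tensor M N).carrier →ₗ[ℂ] P.carrier)
    (hl : ∀ a m n, f (tmul M N (M.left a m) n) = P.left a (f (tmul M N m n)))
    (hr : ∀ a m n, f (tmul M N m (N.right a n)) = P.right a (f (tmul M N m n))) :
    tensor M N ⟶ P :=
  Hom.mk f
    (fun a => LinearMap.congr_fun (f := f ∘ₗ (tensor M N).left a) (g := P.left a ∘ₗ f)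
      (lin_ext fun m n => by simp [hl]))
    (fun a => LinearMap.congr_fun (f := f ∘ₗ (tensor M N).right a) (g := P.right a ∘ₗ f)
      (lin_ext fun m n => by simp [hr]))

@[simp] theorem lin_mkT {M N P : GrBimod 𝒜} (f : (tensor M N).carrier →ₗ[ℂ] P.carrier) (hl hr) :
    Hom.lin (Hom.mkT f hl hr) = f := rfl

/-- Two maps out of `M ⊗_R N` agree if they agree on pure tensors. -/
theorem hom_ext₂ {M N P : GrBimod 𝒜} {f g : tensor M N ⟶ P}
    (h : ∀ m n, Hom.lin f (tmul M N m n) = Hom.lin g (tmul M N m n)) : f = g :=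
  hom_ext (lin_ext h)

theorem hom_ext₃ {M N P Q : GrBimod 𝒜} {f g : tensor (tensor M N) P ⟶ Q}
    (h : ∀ m n p, Hom.lin f (tmul _ P (tmul M N m n) p) = Hom.lin g (tmul _ P (tmul M N m n) p)) :
    f = g :=
  hom_ext₂ fun x p => LinearMap.congr_fun
    (f := Hom.lin f ∘ₗ (tmul (tensor M N) P).flip p)
    (g := Hom.lin g ∘ₗ (tmul (tensor M N) P).flip p) (lin_ext fun m n => h m n p) x

theorem hom_ext₃' {M N P Q : GrBimod 𝒜} {f g : tensor M (tensor N P) ⟶ Q}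
    (h : ∀ m n p, Hom.lin f (tmul M _ m (tmul N P n p)) = Hom.lin g (tmul M _ m (tmul N P n p))) :
    f = g :=
  hom_ext₂ fun m x => LinearMap.congr_fun
    (f := Hom.lin f ∘ₗ tmul M (tensor N P) m)
    (g := Hom.lin g ∘ₗ tmul M (tensor N P) m) (lin_ext fun n p => h m n p) x

theorem hom_ext₄ {M N P Q T : GrBimod 𝒜} {f g : tensor (tensor (tensor M N) P) Q ⟶ T}
    (h : ∀ m n p q, Hom.lin f (tmul _ Q (tmul _ P (tmul M N m n) p) q) =
      Hom.lin g (tmul _ Q (tmul _ P (tmul M N m n) p) q)) : f = g :=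
  hom_ext₃ fun x p q => LinearMap.congr_fun
    (f := Hom.lin f ∘ₗ (tmul (tensor (tensor M N) P) Q).flip q ∘ₗ (tmul (tensor M N) P).flip p)
    (g := Hom.lin g ∘ₗ (tmul (tensor (tensor M N) P) Q).flip q ∘ₗ (tmul (tensor M N) P).flip p)
    (lin_ext fun m n => h m n p q) x

/-- The tensor product of two bimodule maps. -/
def mapHom {M N M' N' : GrBimod 𝒜} (f : M ⟶ M') (g : N ⟶ N') : tensor M N ⟶ tensor M' N' :=
  Hom.mkT (lift ((tmul M' N').compl₁₂ (Hom.lin f) (Hom.lin g))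
      (fun r m n => by simp [lin_left, lin_right, tmul_rel]))
    (fun a m n => by simp [lin_left]) (fun a m n => by simp [lin_right])

@[simp] theorem mapHom_tmul {M N M' N' : GrBimod 𝒜} (f : M ⟶ M') (g : N ⟶ N')
    (m : M.carrier) (n : N.carrier) :
    Hom.lin (mapHom f g) (tmul M N m n) = tmul M' N' (Hom.lin f m) (Hom.lin g n) := by
  simp [mapHom]

/-- The trilinear map `(m ⊗ n, p) ↦ m ⊗ (n ⊗ p)`. -/
def assocAux (M N P : GrBimod 𝒜) :
    (tensor M N).carrier →ₗ[ℂ] P.carrier →ₗ[ℂ] (tensor M (tensor N P)).carrier :=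
  lift (LinearMap.mk₂ ℂ (fun m n => tmul M (tensor N P) m ∘ₗ tmul N P n)
      (fun _ _ _ => LinearMap.ext fun _ => by simp)
      (fun _ _ _ => LinearMap.ext fun _ => by simp)
      (fun _ _ _ => LinearMap.ext fun _ => by simp)
      (fun _ _ _ => LinearMap.ext fun _ => by simp))
    (fun r m n => LinearMap.ext fun p => by simp [tmul_rel])

@[simp] theorem assocAux_tmul (M N P : GrBimod 𝒜) (m : M.carrier) (n : N.carrier)
    (p : P.carrier) : assocAux M N P (tmul M N m n) p = tmul M _ m (tmul N P n p) := by
  simp [assocAux]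

theorem assocAux_rel (M N P : GrBimod 𝒜) (r : R) (x : (tensor M N).carrier) (p : P.carrier) :
    assocAux M N P ((tensor M N).right r x) p = assocAux M N P x (P.left r p) :=
  LinearMap.congr_fun (f := (assocAux M N P).flip p ∘ₗ (tensor M N).right r)
    (g := (assocAux M N P).flip (P.left r p)) (lin_ext fun m n => by simp [tmul_rel]) x

/-- The associator `(m ⊗ n) ⊗ p ↦ m ⊗ (n ⊗ p)`. -/
def assocHom (M N P : GrBimod 𝒜) : tensor (tensor M N) P ⟶ tensor M (tensor N P) :=
  Hom.mkT (lift (assocAux M N P) (assocAux_rel M N P))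
    (fun a x p => by
      rw [lift_tmul, lift_tmul]
      exact LinearMap.congr_fun (f := (assocAux M N P).flip p ∘ₗ (tensor M N).left a)
        (g := (tensor M (tensor N P)).left a ∘ₗ (assocAux M N P).flip p)
        (lin_ext fun m n => by simp) x)
    (fun a x p => by
      rw [lift_tmul, lift_tmul]
      exact LinearMap.congr_fun (f := (assocAux M N P).flip (P.right a p))
        (g := (tensor M (tensor N P)).right a ∘ₗ (assocAux M N P).flip p)
        (lin_ext fun m n => by simp) x)

@[simp] theorem assocHom_tmul (M N P : GrBimod 𝒜) (m : M.carrier) (n : N.carrier)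
    (p : P.carrier) : Hom.lin (assocHom M N P) (tmul _ P (tmul M N m n) p) =
      tmul M _ m (tmul N P n p) := by
  simp [assocHom]

/-- The trilinear map `(m, n ⊗ p) ↦ (m ⊗ n) ⊗ p`. -/
def assocInvAux (M N P : GrBimod 𝒜) :
    M.carrier →ₗ[ℂ] (tensor N P).carrier →ₗ[ℂ] (tensor (tensor M N) P).carrier :=
  (lift (LinearMap.mk₂ ℂ (fun n p => (tmul (tensor M N) P).flip p ∘ₗ (tmul M N).flip n)
      (fun _ _ _ => LinearMap.ext fun _ => by simp)
      (fun _ _ _ => LinearMap.ext fun _ => by simp)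
      (fun _ _ _ => LinearMap.ext fun _ => by simp)
      (fun _ _ _ => LinearMap.ext fun _ => by simp))
    (fun r n p => LinearMap.ext fun m => by simp [← tmul_rel])).flip

@[simp] theorem assocInvAux_tmul (M N P : GrBimod 𝒜) (m : M.carrier) (n : N.carrier)
    (p : P.carrier) : assocInvAux M N P m (tmul N P n p) = tmul _ P (tmul M N m n) p := by
  simp [assocInvAux]

theorem assocInvAux_rel (M N P : GrBimod 𝒜) (r : R) (m : M.carrier) (x : (tensor N P).carrier) :
    assocInvAux M N P (M.right r m) x = assocInvAux M N P m ((tensor N P).left r x) :=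
  LinearMap.congr_fun (f := assocInvAux M N P (M.right r m))
    (g := assocInvAux M N P m ∘ₗ (tensor N P).left r) (lin_ext fun n p => by simp [tmul_rel]) x

/-- The inverse associator `m ⊗ (n ⊗ p) ↦ (m ⊗ n) ⊗ p`. -/
def assocInv (M N P : GrBimod 𝒜) : tensor M (tensor N P) ⟶ tensor (tensor M N) P :=
  Hom.mkT (lift (assocInvAux M N P) (assocInvAux_rel M N P))
    (fun a m x => by
      rw [lift_tmul, lift_tmul]
      exact LinearMap.congr_fun (f := assocInvAux M N P (M.left a m))
        (g := (tensor (tensor M N) P).left a ∘ₗ assocInvAux M N P m)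
        (lin_ext fun n p => by simp) x)
    (fun a m x => by
      rw [lift_tmul, lift_tmul]
      exact LinearMap.congr_fun (f := assocInvAux M N P m ∘ₗ (tensor N P).right a)
        (g := (tensor (tensor M N) P).right a ∘ₗ assocInvAux M N P m)
        (lin_ext fun n p => by simp) x)

@[simp] theorem assocInv_tmul (M N P : GrBimod 𝒜) (m : M.carrier) (n : N.carrier)
    (p : P.carrier) : Hom.lin (assocInv M N P) (tmul M _ m (tmul N P n p)) =
      tmul _ P (tmul M N m n) p := by
  simp [assocInv]

variable (𝒜) in
/-- The regular bimodule `R`. -/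
def unit : GrBimod 𝒜 where
  carrier := R
  left := Algebra.lmul ℂ R
  right := Algebra.lmul ℂ R
  left_right a b m := mul_left_comm a b m
  gr := 𝒜

variable (𝒜) in
/-- The generator `1` of the regular bimodule. -/
def one : (unit 𝒜).carrier := (1 : R)

/-- The left action of the elements of the regular bimodule. -/
def actL (M : GrBimod 𝒜) : (unit 𝒜).carrier →ₗ[ℂ] M.carrier →ₗ[ℂ] M.carrier :=
  M.left.toLinearMap

/-- The right action of the elements of the regular bimodule. -/
def actR (M : GrBimod 𝒜) : (unit 𝒜).carrier →ₗ[ℂ] M.carrier →ₗ[ℂ] M.carrier :=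
  M.right.toLinearMap

theorem actL_left (M : GrBimod 𝒜) (a : R) (u : (unit 𝒜).carrier) (m : M.carrier) :
    actL M ((unit 𝒜).left a u) m = M.left a (actL M u m) :=
  LinearMap.congr_fun (map_mul M.left a (@id R u)) m

theorem actL_right (M : GrBimod 𝒜) (a : R) (u : (unit 𝒜).carrier) (m : M.carrier) :
    actL M ((unit 𝒜).right a u) m = actL M u (M.left a m) :=
  (congrArg (fun x : R => M.left x m) (mul_comm (G := R) a u)).trans
    (LinearMap.congr_fun (map_mul M.left (@id R u) a) m)

theorem actR_right (M : GrBimod 𝒜) (a : R) (u : (unit 𝒜).carrier) (m : M.carrier) :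
    actR M ((unit 𝒜).right a u) m = M.right a (actR M u m) :=
  LinearMap.congr_fun (map_mul M.right a (@id R u)) m

theorem actR_left (M : GrBimod 𝒜) (a : R) (u : (unit 𝒜).carrier) (m : M.carrier) :
    actR M ((unit 𝒜).left a u) m = actR M u (M.right a m) :=
  (congrArg (fun x : R => M.right x m) (mul_comm (G := R) a u)).trans
    (LinearMap.congr_fun (map_mul M.right (@id R u) a) m)

@[simp] theorem actL_one (M : GrBimod 𝒜) (m : M.carrier) : actL M (one 𝒜) m = m :=
  LinearMap.congr_fun (map_one M.left) m

@[simp] theorem actR_one (M : GrBimod 𝒜) (m : M.carrier) : actR M (one 𝒜) m = m :=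
  LinearMap.congr_fun (map_one M.right) m

theorem lin_actL {M N : GrBimod 𝒜} (f : M ⟶ N) (u : (unit 𝒜).carrier) (m : M.carrier) :
    Hom.lin f (actL M u m) = actL N u (Hom.lin f m) := lin_left f u m

theorem lin_actR {M N : GrBimod 𝒜} (f : M ⟶ N) (u : (unit 𝒜).carrier) (m : M.carrier) :
    Hom.lin f (actR M u m) = actR N u (Hom.lin f m) := lin_right f u m

theorem tmul_act {M N : GrBimod 𝒜} (u : (unit 𝒜).carrier) (m : M.carrier) (n : N.carrier) :
    tmul M N (actR M u m) n = tmul M N m (actL N u n) := tmul_rel (@id R u) m n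

theorem actR_unit_one (u : (unit 𝒜).carrier) : actR (unit 𝒜) u (one 𝒜) = u := mul_one (@id R u)
theorem actL_unit_one (u : (unit 𝒜).carrier) : actL (unit 𝒜) u (one 𝒜) = u := mul_one (@id R u)
theorem left_one (a : R) : (unit 𝒜).left a (one 𝒜) = (unit 𝒜).right a (one 𝒜) := rfl

/-- The left unitor `r ⊗ m ↦ r · m`. -/
def unitL (M : GrBimod 𝒜) : tensor (unit 𝒜) M ⟶ M :=
  Hom.mkT (lift (actL M) (fun r m n => actL_right M r m n))
    (fun a m n => by simp [actL_left])
    (fun a m n => by rw [lift_tmul, lift_tmul]; exact M.left_right m a n)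

@[simp] theorem unitL_tmul (M : GrBimod 𝒜) (r : (unit 𝒜).carrier) (m : M.carrier) :
    Hom.lin (unitL M) (tmul (unit 𝒜) M r m) = actL M r m := by
  simp [unitL]

theorem actR_rel (M : GrBimod 𝒜) (r : R) (m : M.carrier) (u : (unit 𝒜).carrier) :
    (actR M).flip (M.right r m) u = (actR M).flip m ((unit 𝒜).left r u) :=
  (actR_left M r u m).symm

/-- The right unitor `m ⊗ r ↦ m · r`. -/
def unitR (M : GrBimod 𝒜) : tensor M (unit 𝒜) ⟶ M :=
  Hom.mkT (lift (actR M).flip (actR_rel M))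
    (fun a n m => by rw [lift_tmul, lift_tmul]; exact (M.left_right a m n).symm)
    (fun a n m => by simp [actR_right])

@[simp] theorem unitR_tmul (M : GrBimod 𝒜) (r : (unit 𝒜).carrier) (m : M.carrier) :
    Hom.lin (unitR M) (tmul M (unit 𝒜) m r) = actR M r m := by
  simp [unitR]

/-- The inverse of the left unitor, `m ↦ 1 ⊗ m`. -/
def unitLInv (M : GrBimod 𝒜) : M ⟶ tensor (unit 𝒜) M :=
  Hom.mk (tmul (unit 𝒜) M (one 𝒜))
    (fun a m => by rw [left_tmul, ← tmul_rel, left_one])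
    (fun a m => by rw [right_tmul])

/-- The inverse of the right unitor, `m ↦ m ⊗ 1`. -/
def unitRInv (M : GrBimod 𝒜) : M ⟶ tensor M (unit 𝒜) :=
  Hom.mk ((tmul M (unit 𝒜)).flip (one 𝒜))
    (fun a m => by simp)
    (fun a m => by simp [tmul_rel, left_one])

@[simp] theorem unitLInv_apply (M : GrBimod 𝒜) (m : M.carrier) :
    Hom.lin (unitLInv M) m = tmul (unit 𝒜) M (one 𝒜) m := rfl
@[simp] theorem unitRInv_apply (M : GrBimod 𝒜) (m : M.carrier) :
    Hom.lin (unitRInv M) m = tmul M (unit 𝒜) m (one 𝒜) := rfl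

instance : MonoidalCategoryStruct (GrBimod 𝒜) where
  tensorObj := tensor
  whiskerLeft M _ _ f := mapHom (𝟙 M) f
  whiskerRight f N := mapHom f (𝟙 N)
  tensorHom f g := mapHom f g
  tensorUnit := unit 𝒜
  associator M N P :=
    { hom := assocHom M N P
      inv := assocInv M N P
      hom_inv_id := hom_ext₃ fun m n p => by simp
      inv_hom_id := hom_ext₃' fun m n p => by simp }
  leftUnitor M :=
    { hom := unitL M
      inv := unitLInv M
      hom_inv_id := hom_ext₂ fun r m => by simp [← tmul_act, actR_unit_one]
      inv_hom_id := hom_ext (LinearMap.ext fun m => by simp) }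
  rightUnitor M :=
    { hom := unitR M
      inv := unitRInv M
      hom_inv_id := hom_ext₂ fun m r => by simp [tmul_act, actL_unit_one]
      inv_hom_id := hom_ext (LinearMap.ext fun m => by simp) }

instance : MonoidalCategory (GrBimod 𝒜) where
  tensorHom_def f g := hom_ext₂ fun m n => by
    change Hom.lin (mapHom f g) _ = Hom.lin (mapHom f (𝟙 _) ≫ mapHom (𝟙 _) g) _
    simp
  id_tensorHom_id M N := hom_ext₂ fun m n => by
    change Hom.lin (mapHom (𝟙 M) (𝟙 N)) _ = _
    simp; rfl
  tensorHom_comp_tensorHom f₁ f₂ g₁ g₂ := hom_ext₂ fun m n => by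
    change Hom.lin (mapHom f₁ f₂ ≫ mapHom g₁ g₂) _ = Hom.lin (mapHom _ _) _
    simp
  whiskerLeft_id M N := hom_ext₂ fun m n => by
    change Hom.lin (mapHom (𝟙 M) (𝟙 N)) _ = _
    simp; rfl
  id_whiskerRight M N := hom_ext₂ fun m n => by
    change Hom.lin (mapHom (𝟙 M) (𝟙 N)) _ = _
    simp; rfl
  associator_naturality f₁ f₂ f₃ := hom_ext₃ fun m n p => by
    change Hom.lin (mapHom (mapHom f₁ f₂) f₃ ≫ assocHom _ _ _) _ =
      Hom.lin (assocHom _ _ _ ≫ mapHom f₁ (mapHom f₂ f₃)) _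
    simp
  leftUnitor_naturality {M N} f := hom_ext₂ (M := unit 𝒜) fun r m => by
    change Hom.lin (mapHom (𝟙 (unit 𝒜)) f ≫ unitL N) _ = Hom.lin (unitL M ≫ f) _
    simp [lin_actL]
  rightUnitor_naturality {M N} f := hom_ext₂ (N := unit 𝒜) fun m r => by
    change Hom.lin (mapHom f (𝟙 (unit 𝒜)) ≫ unitR N) _ = Hom.lin (unitR M ≫ f) _
    simp [lin_actR]
  pentagon M N P Q := hom_ext₄ fun m n p q => by
    change Hom.lin (mapHom (assocHom M N P) (𝟙 Q) ≫ assocHom M (tensor N P) Q ≫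
      mapHom (𝟙 M) (assocHom N P Q)) _ =
        Hom.lin (assocHom (tensor M N) P Q ≫ assocHom M N (tensor P Q)) _
    simp
  triangle M N := hom_ext₃ (N := unit 𝒜) fun m r n => by
    change Hom.lin (assocHom M (unit 𝒜) N ≫ mapHom (𝟙 M) (unitL N)) _ =
      Hom.lin (mapHom (unitR M) (𝟙 N)) _
    simp [tmul_act]

instance : MonoidalPreadditive (GrBimod 𝒜) where
  whiskerLeft_zero {M N P} := hom_ext₂ fun m n => by
    change Hom.lin (mapHom (𝟙 M) 0) _ = 0
    rw [mapHom_tmul]; exact map_zero _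
  zero_whiskerRight {M N P} := hom_ext₂ fun m n => by
    change Hom.lin (mapHom 0 (𝟙 M)) _ = 0
    rw [mapHom_tmul]; exact LinearMap.map_zero₂ _ _
  whiskerLeft_add {M N P} f g := hom_ext₂ fun m n => by
    change Hom.lin (mapHom (𝟙 M) (f + g)) _ =
      Hom.lin (mapHom (𝟙 M) f) _ + Hom.lin (mapHom (𝟙 M) g) _
    simp
  add_whiskerRight {M N P} f g := hom_ext₂ fun m n => by
    change Hom.lin (mapHom (f + g) (𝟙 M)) _ =
      Hom.lin (mapHom f (𝟙 M)) _ + Hom.lin (mapHom g (𝟙 M)) _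
    simp

instance : MonoidalLinear ℂ (GrBimod 𝒜) where
  whiskerLeft_smul M _ _ c f := hom_ext₂ fun m n => by
    change Hom.lin (mapHom (𝟙 M) (c • f)) _ = c • Hom.lin (mapHom (𝟙 M) f) _
    simp
  smul_whiskerRight c _ _ f M := hom_ext₂ fun m n => by
    change Hom.lin (mapHom (c • f) (𝟙 M)) _ = c • Hom.lin (mapHom f (𝟙 M)) _
    simp

end tensor
end GrBimod
end

noncomputable section
universe u

namespace GrBimod

variable {R : Type u} [CommRing R] [Algebra ℂ R] {𝒜 : ℤ → Submodule ℂ R}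

/-- The grading shift `M(n)`, with `M(n)_i = M_{i+n}`. -/
def shift (M : GrBimod 𝒜) (n : ℤ) : GrBimod 𝒜 where
  carrier := M.carrier
  left := M.left
  right := M.right
  left_right := M.left_right
  gr i := M.gr (i + n)

/-- The direct sum of two graded bimodules. -/
def directSum (M N : GrBimod 𝒜) : GrBimod 𝒜 where
  carrier := M.carrier × N.carrier
  left := AlgHom.ofLinearMap
    { toFun := fun a => (M.left a).prodMap (N.left a)
      map_add' := fun a b => LinearMap.ext fun x => by simp
      map_smul' := fun c a => LinearMap.ext fun x => by simp }
    (LinearMap.ext fun x => by simp) (fun a b => LinearMap.ext fun x => by simp)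
  right := AlgHom.ofLinearMap
    { toFun := fun a => (M.right a).prodMap (N.right a)
      map_add' := fun a b => LinearMap.ext fun x => by simp
      map_smul' := fun c a => LinearMap.ext fun x => by simp }
    (LinearMap.ext fun x => by simp) (fun a b => LinearMap.ext fun x => by simp)
  left_right a b x := Prod.ext (M.left_right a b x.1) (N.left_right a b x.2)
  gr i := (M.gr i).prod (N.gr i)

/-- A bimodule map is homogeneous of degree `0` if it preserves the graded pieces. -/
def IsDegreeZero {M N : GrBimod 𝒜} (f : M ⟶ N) : Prop :=
  ∀ i, ∀ m ∈ M.gr i, Hom.lin f m ∈ N.gr i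

/-- `N` is a graded direct summand of `M`. -/
def IsSummand (N M : GrBimod 𝒜) : Prop :=
  ∃ (i : N ⟶ M) (p : M ⟶ N), IsDegreeZero i ∧ IsDegreeZero p ∧ i ≫ p = 𝟙 N

variable (𝒜) in
/-- The graded bimodule `R ⊗_A R` for a subalgebra `A` of `R`. -/
def bs (A : Subalgebra ℂ R) : GrBimod 𝒜 where
  carrier := R ⊗[A] R
  left := (Algebra.lmul ℂ (R ⊗[A] R)).comp
    (Algebra.TensorProduct.includeLeft : R →ₐ[ℂ] R ⊗[A] R)
  right := (Algebra.lmul ℂ (R ⊗[A] R)).comp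
    ((Algebra.TensorProduct.includeRight : R →ₐ[A] R ⊗[A] R).restrictScalars ℂ)
  left_right _ _ m := mul_left_comm _ _ m
  gr i := Submodule.span ℂ {x | ∃ j k, j + k = i ∧ ∃ a ∈ 𝒜 j, ∃ b ∈ 𝒜 k, x = a ⊗ₜ[A] b}

end GrBimod

/-! ### Realizations of Coxeter systems -/

/-- The two-coloured quantum numbers: `[0] = 0`, `[1] = 1` and `[n+2]_x = x [n+1]_y - [n]_x`. -/
def quantumNumber (x y : ℂ) : ℕ → ℂ
  | 0 => 0
  | 1 => 1
  | n + 2 => x * quantumNumber y x (n + 1) - quantumNumber x y n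

variable {B W : Type*} [Group W] {M : CoxeterMatrix B}

/-- A realization over `ℂ` of a Coxeter system, on a complex vector space `V`. -/
structure Realization (cs : CoxeterSystem M W) (V : Type*) [AddCommGroup V] [Module ℂ V] where
  /-- the simple coroots `α_s^∨` -/
  coroot : B → V
  /-- the simple roots `α_s` -/
  root : B → Module.Dual ℂ V
  root_coroot_self : ∀ s, root s (coroot s) = 2
  /-- the action of `W` on `V` -/
  rep : Representation ℂ W V
  rep_simple : ∀ s v, rep (cs.simple s) v = v - root s v • coroot s
  /-- the technical condition `[m_{st}] = 0` for `m_{st} < ∞` -/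
  quantum : ∀ s t, s ≠ t → M s t ≠ 0 →
    quantumNumber (-root t (coroot s)) (-root s (coroot t)) (M s t) = 0

namespace Realization

variable {cs : CoxeterSystem M W} {V : Type u} [AddCommGroup V] [Module ℂ V]

/-- A realization is balanced if `[m_{st} - 1] = 1` for all `s ≠ t` with `m_{st} < ∞`. -/
def Balanced (h : Realization cs V) : Prop :=
  ∀ s t, s ≠ t → M s t ≠ 0 →
    quantumNumber (-h.root t (h.coroot s)) (-h.root s (h.coroot t)) (M s t - 1) = 1

/-- A realization is reflection faithful if `W` acts faithfully, and the elements whose fixed space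
has codimension `1` are exactly the reflections, that is, the conjugates of simple reflections. -/
def ReflectionFaithful (h : Realization cs V) : Prop :=
  Function.Injective h.rep ∧
    ∀ w : W, Module.finrank ℂ (LinearMap.ker (h.rep w - 1)) + 1 = Module.finrank ℂ V ↔
      cs.IsReflection w

/-- The polynomial ring `R = ℂ[V] = Sym(V^*)`. -/
abbrev polyRing (_ : Realization cs V) : Type u := SymmetricAlgebra ℂ (Module.Dual ℂ V)

/-- The grading of `R = Sym(V^*)`, with `V^*` in degree `2`. -/
def polyGrading (h : Realization cs V) (i : ℤ) : Submodule ℂ h.polyRing :=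
  ⨆ (k : ℕ) (_ : i = 2 * k), LinearMap.range (SymmetricAlgebra.ι ℂ (Module.Dual ℂ V)) ^ k

/-- The action of `w ∈ W` on `R = Sym(V^*)`, induced by the dual of the representation `V`. -/
def act (h : Realization cs V) (w : W) : h.polyRing →ₐ[ℂ] h.polyRing :=
  SymmetricAlgebra.lift (SymmetricAlgebra.ι ℂ (Module.Dual ℂ V) ∘ₗ h.rep.dual w)

/-- The subalgebra of `R` of the elements fixed by all `w ∈ H`. -/
def invariants (h : Realization cs V) (H : Set W) : Subalgebra ℂ h.polyRing where
  carrier := {f | ∀ w ∈ H, h.act w f = f}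
  mul_mem' hf hg w hw := by rw [map_mul, hf w hw, hg w hw]
  add_mem' hf hg w hw := by rw [map_add, hf w hw, hg w hw]
  algebraMap_mem' c w _ := AlgHom.commutes _ c

variable (cs) in
/-- The standard parabolic subgroup `W_I`. -/
def parabolic (I : Set B) : Subgroup W := Subgroup.closure (cs.simple '' I)

/-- The bimodule `B_s = R ⊗_{R^s} R (1)`. -/
def simpleBimod (h : Realization cs V) (s : B) : GrBimod h.polyGrading :=
  (GrBimod.bs h.polyGrading (h.invariants {cs.simple s})).shift 1

/-- The generalised Bott–Samelson bimodule `B_I = R ⊗_{R^I} R`, where `R^I` is the ring of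
`W_I`-invariants. -/
def genBS (h : Realization cs V) (I : Set B) : GrBimod h.polyGrading :=
  GrBimod.bs h.polyGrading (h.invariants (parabolic cs I))

/-- Soergel bimodules: the smallest class of graded `R`-`R`-bimodules that contains `R` and the
`B_s`, and is closed under tensor products, grading shifts, direct sums and direct summands (in
particular, under isomorphisms). -/
inductive IsSoergel (h : Realization cs V) : GrBimod h.polyGrading → Prop
  | unit : IsSoergel h (GrBimod.unit h.polyGrading)
  | simple (s : B) : IsSoergel h (h.simpleBimod s)
  | tensor {M N : GrBimod h.polyGrading} :
      IsSoergel h M → IsSoergel h N → IsSoergel h (M.tensor N)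
  | shift {M : GrBimod h.polyGrading} (n : ℤ) : IsSoergel h M → IsSoergel h (M.shift n)
  | directSum {M N : GrBimod h.polyGrading} :
      IsSoergel h M → IsSoergel h N → IsSoergel h (M.directSum N)
  | summand {M N : GrBimod h.polyGrading} : N.IsSummand M → IsSoergel h M → IsSoergel h N

/-- Soergel bimodules as a property of objects of the category of graded bimodules. -/
def soergel (h : Realization cs V) : ObjectProperty (GrBimod h.polyGrading) := h.IsSoergel

instance (h : Realization cs V) : h.soergel.IsMonoidal where
  prop_unit := .unit
  prop_tensor _ _ h₁ h₂ := .tensor h₁ h₂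

/-- The monoidal category `SBim(W)` of Soergel bimodules. -/
abbrev SBim (h : Realization cs V) : Type (u + 1) := h.soergel.FullSubcategory

end Realization

end

/-! Write A = R^I, n = |W_I| and X = B_I = R ⊗_A R. Everything rests on two facts about A ⊂ R: R is
free over A of rank n, and some composite of Demazure operators ∂_s with s ∈ I is a Frobenius form F
: R → A with homogeneous dual bases b, b'.

Freeness gives the isomorphism. Inserting b_i in the middle of x ⊗ y, and applying the i-th
coordinate to the middle of x ⊗ y ⊗ z, identify X ⊗ X with n copies of X. Read in the trace, these
maps go Tr₀(𝟙) → Tr₀(X) and Tr₀(X) → Tr₀(𝟙). In one order the composites are δ_ij [Id_X], by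
cyclicity (`trIns_trProj`). In the other order they sum to n times the class of Id_{X ⊗ X}
(`sum_trProj_trIns`), and that class is the identity of Tr₀(X) (`clsHom_id`). After division by n
this forces [Id_X]/n to be idempotent and splits Tr₀(X) into n copies of its image.

The Frobenius form shows that X is a Soergel bimodule (`isSummand_bsWord`). The Bott–Samelson
bimodule of the word of F maps to End_A(R) by x₀ ⊗ ⋯ ⊗ xₗ ↦ x₀ ∂₁ x₁ ⋯ ∂ₗ xₗ, and End_A(R) maps to X
by T ↦ ∑ T(b_k) ⊗ b'_k. Then 1 ⊗ 1 ↦ 1 ⊗ ⋯ ⊗ 1 ↦ F ↦ 1 ⊗ 1 splits X off.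

For the two facts, let J be the ideal generated by the homogeneous invariants of positive degree. A
homogeneous f ∉ J of degree d is sent to a nonzero constant by some word of d Demazure operators
(`exists_word`): if all ∂_s f were in J, then f would agree modulo J with its average. Hence
independence modulo J implies independence over A. Graded Nakayama gives generation, and Galois
theory gives the rank. The top degree of R/J is a line spanned by a skew element u, and every
nonzero homogeneous class has a multiple that is a nonzero multiple of u. So a word that does not
kill u gives a perfect pairing. -/

noncomputable section

set_option linter.unusedSectionVars false

/-! ### Finite groups generated by reflections acting on a graded domain -/

/-- An action of a group `G` on a graded `ℂ`-algebra with invariants `A`, where `G` is generated by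
reflections `refl s` with roots `root s` in degree one. -/
structure GradedReflectionAction {R : Type*} [CommRing R] [Algebra ℂ R] (G : Type*) [Group G]
    [MulSemiringAction G R] (𝓡 : ℕ → Submodule ℂ R) (A : Subalgebra ℂ R) (S : Type*) where
  mem_iff : ∀ x, x ∈ A ↔ ∀ g : G, g • x = x
  smul_mem : ∀ (g : G) {n : ℕ} {x : R}, x ∈ 𝓡 n → g • x ∈ 𝓡 n
  deg_zero : ∀ x ∈ 𝓡 0, ∃ c, algebraMap ℂ R c = x
  /-- the generating reflections -/
  refl : S → G
  refl_mul_self : ∀ s, refl s * refl s = 1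
  closure_refl : Subgroup.closure (Set.range refl) = ⊤
  /-- the roots -/
  root : S → R
  root_ne_zero : ∀ s, root s ≠ 0
  root_mem : ∀ s, root s ∈ 𝓡 1
  refl_root : ∀ s, refl s • root s = -root s
  dvd : ∀ s f, root s ∣ f - refl s • f
  /-- the sign character -/
  sign : G →* ℤˣ
  sign_refl : ∀ s, sign (refl s) = -1

/-! ### The ideal J of positive-degree invariants and graded Nakayama. -/

section posIdeal

variable {R : Type*} [CommRing R] [Algebra ℂ R] (𝓡 : ℕ → Submodule ℂ R) (A : Subalgebra ℂ R)

/-- The ideal generated by the homogeneous elements of `A` of positive degree. -/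
def posIdeal : Ideal R := Ideal.span {a | a ∈ A ∧ ∃ n, a ∈ 𝓡 (n + 1)}

variable {𝓡 A}

theorem posIdeal_induction {P : R → Prop} (zero : P 0) (add : ∀ x y, P x → P y → P (x + y))
    (mul : ∀ r, ∀ a ∈ A, ∀ n, a ∈ 𝓡 (n + 1) → P (r * a)) {x : R} (hx : x ∈ posIdeal 𝓡 A) : P x := by
  -- Carrying an arbitrary multiplier r through the induction absorbs closure under scalars, so P
  -- itself only has to be additive.
  suffices ∀ r, P (r * x) by simpa using this 1
  induction hx using Submodule.span_induction with
  | mem a ha => exact fun r => mul r a ha.1 _ ha.2.choose_spec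
  | zero => simpa using zero
  | add x y _ _ hx hy => exact fun r => by simpa [mul_add] using add _ _ (hx r) (hy r)
  | smul a x _ hx => exact fun r => by simpa [mul_assoc] using hx (r * a)

theorem mem_posIdeal {a : R} (ha : a ∈ A) {n : ℕ} (hn : a ∈ 𝓡 (n + 1)) : a ∈ posIdeal 𝓡 A :=
  Ideal.subset_span ⟨ha, n, hn⟩

theorem posIdeal_smul_mem (c : ℂ) {x : R} (hx : x ∈ posIdeal 𝓡 A) : c • x ∈ posIdeal 𝓡 A := by
  rw [Algebra.smul_def]; exact Ideal.mul_mem_left _ _ hx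

theorem posIdeal_smul_mem_iff {c : ℂ} (hc : c ≠ 0) {x : R} :
    c • x ∈ posIdeal 𝓡 A ↔ x ∈ posIdeal 𝓡 A :=
  ⟨fun h => by simpa [smul_smul, hc] using posIdeal_smul_mem c⁻¹ h, posIdeal_smul_mem c⟩

/-- The generators of J are scalars for T, so T(r a) = a T(r). Group elements and Demazure operators
therefore act on R/J. -/
theorem map_mem_posIdeal (T : R →ₗ[A] R) {x : R} (hx : x ∈ posIdeal 𝓡 A) :
    T x ∈ posIdeal 𝓡 A := by
  refine posIdeal_induction (P := fun x => T x ∈ posIdeal 𝓡 A) (by simp)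
    (fun x y hx hy => ?_) (fun r a ha n hn => ?_) hx
  · rw [map_add]; exact add_mem hx hy
  · rw [mul_comm, show a * r = (⟨a, ha⟩ : A) • r from rfl, map_smul]
    exact Ideal.mul_mem_right _ _ (mem_posIdeal ha hn)

theorem eq_zero_of_sum_mem_posIdeal {κ : Type*} {f : κ → R}
    (hli : LinearIndependent ℂ fun k => Ideal.Quotient.mkₐ ℂ (posIdeal 𝓡 A) (f k))
    (t : Finset κ) (c : κ → ℂ) (h : ∑ k ∈ t, c k • f k ∈ posIdeal 𝓡 A) : ∀ k ∈ t, c k = 0 := by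
  refine linearIndependent_iff'.1 hli t c ?_
  rw [← Ideal.Quotient.eq_zero_iff_mem, ← Ideal.Quotient.mkₐ_eq_mk ℂ, map_sum] at h
  simpa using h

variable [GradedAlgebra 𝓡]

theorem decompose_mem_posIdeal {x : R} (hx : x ∈ posIdeal 𝓡 A) (n : ℕ) :
    (DirectSum.decompose 𝓡 x n : R) ∈ posIdeal 𝓡 A :=
  Ideal.homogeneous_span 𝓡 _ (fun _ ha => ⟨_, ha.2.choose_spec⟩) n hx

theorem eq_zero_of_mem_posIdeal {x : R} (hx : x ∈ posIdeal 𝓡 A) (h0 : x ∈ 𝓡 0) : x = 0 := by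
  rw [← DirectSum.decompose_of_mem_same 𝓡 h0]
  refine posIdeal_induction (P := fun x => (DirectSum.decompose 𝓡 x 0 : R) = 0) (by simp)
    (fun x y hx hy => by simp [hx, hy]) (fun r a _ n hn => ?_) hx
  exact DirectSum.coe_decompose_mul_of_right_mem_of_not_le 𝓡 hn (by simp)

theorem one_notMem_posIdeal [Nontrivial R] : (1 : R) ∉ posIdeal 𝓡 A := fun h =>
  one_ne_zero (eq_zero_of_mem_posIdeal h SetLike.GradedOne.one_mem)

/-- Inductive step of graded Nakayama: since a has positive degree, the degree-d component of r * a
is a times a component of r of degree below d. -/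
theorem decompose_mem_of_mem_posIdeal {M : Submodule A R} {d : ℕ} (hM : ∀ m < d, ∀ x ∈ 𝓡 m, x ∈ M)
    {x : R} (hx : x ∈ posIdeal 𝓡 A) : (DirectSum.decompose 𝓡 x d : R) ∈ M := by
  refine posIdeal_induction (P := fun x => (DirectSum.decompose 𝓡 x d : R) ∈ M) (by simp)
    (fun x y hx hy => by simpa using add_mem hx hy) (fun r a ha n hn => ?_) hx
  rw [DirectSum.coe_decompose_mul_of_right_mem 𝓡 d hn]
  split_ifs with h
  · rw [mul_comm]
    exact M.smul_mem ⟨a, ha⟩ (hM _ (by omega) _ (SetLike.coe_mem _))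
  · exact zero_mem _

/-- Homogeneous elements which span modulo `posIdeal` generate the ring over `A`. -/
theorem span_eq_top_of_homogeneous {κ : Type*} {f : κ → R} {deg : κ → ℕ}
    (hf : ∀ k, f k ∈ 𝓡 (deg k))
    (hs : ∀ x, ∃ y ∈ Submodule.span ℂ (Set.range f), x - y ∈ posIdeal 𝓡 A) :
    Submodule.span A (Set.range f) = ⊤ := by
  classical
  set M := Submodule.span A (Set.range f)
  have key : ∀ d, ∀ x ∈ 𝓡 d, x ∈ M := by
    intro d
    induction d using Nat.strong_induction_on with
    | _ d ih =>
      intro x hx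
      -- Only the degree-d components of y and x - y matter. The first is a combination of the `f
      -- k`, the second reduces to lower degrees.
      obtain ⟨y, hy, hxy⟩ := hs x
      have h1 := decompose_mem_of_mem_posIdeal ih hxy
      have h2 : (DirectSum.decompose 𝓡 y d : R) ∈ M := by
        clear hxy h1
        induction hy using Submodule.span_induction with
        | mem y hy =>
          obtain ⟨k, rfl⟩ := hy
          rw [DirectSum.decompose_of_mem 𝓡 (hf k), DirectSum.coe_of_apply]
          split_ifs
          · exact Submodule.subset_span ⟨k, rfl⟩
          · exact zero_mem _
        | zero => simp
        | add x y _ _ hx hy => simpa using add_mem hx hy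
        | smul c x _ hx =>
          rw [DirectSum.decompose_smul]
          change c • (DirectSum.decompose 𝓡 x d : R) ∈ M
          rw [← algebraMap_smul A c]
          exact M.smul_mem _ hx
      rw [← DirectSum.decompose_of_mem_same 𝓡 hx]
      simpa using add_mem h1 h2
  refine eq_top_iff.2 fun x _ => ?_
  rw [← DirectSum.sum_support_decompose 𝓡 x]
  exact sum_mem fun d _ => key d _ (SetLike.coe_mem _)

end posIdeal

/-! ### Demazure operators and independence over the invariants. -/

namespace GradedReflectionAction

variable {R : Type*} [CommRing R] [IsDomain R] [Algebra ℂ R] {G : Type*} [Group G]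
  [MulSemiringAction G R] {𝓡 : ℕ → Submodule ℂ R} [GradedAlgebra 𝓡]
  {A : Subalgebra ℂ R} {S : Type*} (H : GradedReflectionAction G 𝓡 A S)

include H in
theorem smul_mul_of_mem (g : G) {a : R} (ha : a ∈ A) (x : R) : g • (a * x) = a * g • x := by
  rw [smul_mul', (H.mem_iff a).1 ha]

/-- The action of a group element as an `A`-linear map. -/
def smulLin (g : G) : R →ₗ[A] R where
  toFun x := g • x
  map_add' := smul_add g
  map_smul' a x := H.smul_mul_of_mem g a.2 x

include H in
theorem smul_mem_posIdeal (g : G) {x : R} (hx : x ∈ posIdeal 𝓡 A) : g • x ∈ posIdeal 𝓡 A :=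
  map_mem_posIdeal (H.smulLin g) hx

include H in
theorem smul_complex_smul (g : G) (c : ℂ) (x : R) : g • (c • x) = c • g • x := by
  rw [Algebra.smul_def, Algebra.smul_def, H.smul_mul_of_mem g (A.algebraMap_mem c)]

/-- The Demazure operator of the reflection `s`. -/
def demazure (s : S) : R →ₗ[A] R where
  toFun f := (H.dvd s f).choose
  map_add' f g := mul_left_cancel₀ (H.root_ne_zero s) (by
    rw [mul_add, ← (H.dvd s _).choose_spec, ← (H.dvd s _).choose_spec, ← (H.dvd s _).choose_spec,
      smul_add]
    ring)
  map_smul' a f := mul_left_cancel₀ (H.root_ne_zero s) (by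
    rw [RingHom.id_apply, mul_smul_comm, ← (H.dvd s _).choose_spec, ← (H.dvd s _).choose_spec,
      smul_sub]
    exact congrArg _ (H.smul_mul_of_mem _ a.2 f))

theorem root_mul_demazure (s : S) (f : R) : H.root s * H.demazure s f = f - H.refl s • f :=
  (H.dvd s f).choose_spec.symm

theorem demazure_eq_zero_iff (s : S) (f : R) : H.demazure s f = 0 ↔ H.refl s • f = f := by
  rw [← mul_right_inj' (H.root_ne_zero s), root_mul_demazure, mul_zero, sub_eq_zero, eq_comm]

/-- In root * ∂f = f - s f, both the root and the right-hand side change sign under s. -/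
theorem refl_smul_demazure (s : S) (f : R) : H.refl s • H.demazure s f = H.demazure s f := by
  have h2 : H.refl s • H.refl s • f = f := by rw [← mul_smul, refl_mul_self, one_smul]
  have h := congrArg (H.refl s • ·) (H.root_mul_demazure s f)
  simp only [smul_mul', H.refl_root, smul_sub, h2] at h
  refine mul_left_cancel₀ (H.root_ne_zero s) ?_
  rw [root_mul_demazure]
  linear_combination -h

/-- Linearity over all s-invariants, a larger ring than A, is what lets ∂_s define a map out of R
⊗_{R^s} R. -/
theorem demazure_mul_of_smul_eq (s : S) {a : R} (ha : H.refl s • a = a) (f : R) :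
    H.demazure s (a * f) = a * H.demazure s f := by
  refine mul_left_cancel₀ (H.root_ne_zero s) ?_
  rw [root_mul_demazure, mul_left_comm, root_mul_demazure, smul_mul', ha, mul_sub]

/-- The product root * ∂f is homogeneous of degree n + 1, so it equals the root times the degree-n
component of ∂f. Cancelling the root shows that ∂f is that component. -/
theorem demazure_mem (s : S) {n : ℕ} {f : R} (hf : f ∈ 𝓡 (n + 1)) : H.demazure s f ∈ 𝓡 n := by
  have h1 : H.root s * H.demazure s f ∈ 𝓡 (n + 1) := by
    rw [root_mul_demazure]; exact sub_mem hf (H.smul_mem _ hf)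
  have h2 := DirectSum.coe_decompose_mul_of_left_mem_of_le 𝓡 (H.root_mem s)
    (Nat.le_add_left 1 n) (b := H.demazure s f)
  rw [DirectSum.decompose_of_mem_same 𝓡 h1, Nat.add_sub_cancel] at h2
  rw [mul_left_cancel₀ (H.root_ne_zero s) h2]
  exact SetLike.coe_mem _

theorem demazure_deg_zero (s : S) {f : R} (hf : f ∈ 𝓡 0) : H.demazure s f = 0 := by
  obtain ⟨c, rfl⟩ := H.deg_zero f hf
  exact (H.demazure_eq_zero_iff s _).2 ((H.mem_iff _).1 (A.algebraMap_mem c) _)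

/-- The composite of the Demazure operators of a word. -/
def demazureWord (w : List S) : Module.End A R := (w.map H.demazure).prod

theorem demazureWord_cons (s : S) (w : List S) (f : R) :
    H.demazureWord (s :: w) f = H.demazure s (H.demazureWord w f) := by
  simp [demazureWord]

theorem demazureWord_mem {w : List S} {m n : ℕ} (hm : m = n + w.length) {f : R} (hf : f ∈ 𝓡 m) :
    H.demazureWord w f ∈ 𝓡 n := by
  induction w generalizing n with
  | nil => simpa [demazureWord, hm] using hf
  | cons s w ih =>
    rw [demazureWord_cons]
    exact H.demazure_mem s (ih (by simp at hm; omega))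

/-- The degree reaches 0 before the word is used up, and the next operator kills constants. -/
theorem demazureWord_eq_zero {w : List S} {m : ℕ} (hm : m < w.length) {f : R} (hf : f ∈ 𝓡 m) :
    H.demazureWord w f = 0 := by
  induction w with
  | nil => simp at hm
  | cons s w ih =>
    rw [demazureWord_cons]
    rcases Nat.lt_or_ge m w.length with h | h
    · rw [ih h, map_zero]
    · exact H.demazure_deg_zero s (H.demazureWord_mem (by simp at hm; omega) hf)

/-- An element which is semi-invariant modulo `posIdeal` lifts to a semi-invariant one. -/
theorem exists_semiinvariant [Finite G] (χ : G →* ℤˣ) {d : ℕ} {f : R} (hf : f ∈ 𝓡 d)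
    (h : ∀ s, f - (χ (H.refl s) : ℤ) • H.refl s • f ∈ posIdeal 𝓡 A) :
    ∃ f' ∈ 𝓡 d, f - f' ∈ posIdeal 𝓡 A ∧ ∀ g : G, g • f' = (χ g : ℤ) • f' := by
  have hu : ∀ u : ℤˣ, (u : ℤ) * u = 1 := fun u => by
    rcases Int.units_eq_one_or u with rfl | rfl <;> rfl
  -- J is G-stable and χ is multiplicative, so the congruence spreads from the generators to G. The
  -- χ-twisted average of f is then congruent to f.
  have key : ∀ g : G, f - (χ g : ℤ) • g • f ∈ posIdeal 𝓡 A := by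
    intro g
    have hg : g ∈ Subgroup.closure (Set.range H.refl) := H.closure_refl ▸ Subgroup.mem_top g
    induction hg using Subgroup.closure_induction with
    | mem g hg => obtain ⟨s, rfl⟩ := hg; exact h s
    | one => simp
    | mul a b _ _ ha hb =>
      have h1 := add_mem ha (zsmul_mem (H.smul_mem_posIdeal a hb) (χ a))
      convert h1 using 1
      simp only [smul_sub, map_mul, Units.val_mul, mul_smul, smul_comm a]
      abel
    | inv a _ ha =>
      have h1 := neg_mem (zsmul_mem (H.smul_mem_posIdeal a⁻¹ ha) (χ a))
      convert h1 using 1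
      simp only [smul_sub, map_inv, Int.units_inv_eq_self, smul_comm a⁻¹, ← mul_smul,
        hu, one_smul, inv_mul_cancel]
      abel
  have := Fintype.ofFinite G
  have hc : (Fintype.card G : ℂ) ≠ 0 := by simp
  refine ⟨(Fintype.card G : ℂ)⁻¹ • ∑ g : G, (χ g : ℤ) • g • f, Submodule.smul_mem _ _
    (sum_mem fun g _ => zsmul_mem (H.smul_mem g hf) _), ?_, fun g => ?_⟩
  · have h1 := posIdeal_smul_mem (Fintype.card G : ℂ)⁻¹ (sum_mem fun g (_ : g ∈ Finset.univ) => key g)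
    rw [Finset.sum_sub_distrib, smul_sub] at h1
    simpa [← Nat.cast_smul_eq_nsmul ℂ, smul_smul, hc] using h1
  · rw [H.smul_complex_smul, smul_comm (χ g : ℤ), Finset.smul_sum (N := R) (r := g),
      Finset.smul_sum (r := (χ g : ℤ))]
    congr 1
    refine Fintype.sum_equiv (Equiv.mulLeft g) _ _ fun x => ?_
    simp only [Equiv.coe_mulLeft, map_mul, Units.val_mul, mul_smul, smul_comm g]
    rw [smul_smul (χ g : ℤ) (χ g : ℤ), hu, one_smul]

/-- The hypothesis says f ≡ s f modulo J for all s, so f is congruent to a homogeneous invariant.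
That invariant has positive degree and hence lies in J; the constant 1 shows that degree 0 must be
excluded. -/
theorem mem_posIdeal_of_demazure [Finite G] {d : ℕ} {f : R} (hf : f ∈ 𝓡 (d + 1))
    (h : ∀ s, H.demazure s f ∈ posIdeal 𝓡 A) : f ∈ posIdeal 𝓡 A := by
  obtain ⟨f', hf', h1, h2⟩ := H.exists_semiinvariant 1 hf fun s => by
    simpa [← root_mul_demazure] using Ideal.mul_mem_left _ (H.root s) (h s)
  rw [← sub_add_cancel f f']
  exact add_mem h1 (mem_posIdeal ((H.mem_iff _).2 fun g => by simpa using h2 g) hf')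

/-- In positive degree some ∂_s keeps f outside J; iterate down to degree 0. The final value is a
nonzero constant, so an A-linear operator detects f modulo J. -/
theorem exists_word [Finite G] {d : ℕ} {f : R} (hf : f ∈ 𝓡 d) (h : f ∉ posIdeal 𝓡 A) :
    ∃ w : List S, w.length = d ∧ H.demazureWord w f ∉ posIdeal 𝓡 A := by
  induction d generalizing f with
  | zero => exact ⟨[], rfl, by simpa [demazureWord] using h⟩
  | succ d ih =>
    obtain ⟨s, hs⟩ := not_forall.1 (mt (H.mem_posIdeal_of_demazure hf) h)
    obtain ⟨w, rfl, hw⟩ := ih (H.demazure_mem s hf) hs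
    -- The new letter goes on the right because ∂_s is applied first.
    exact ⟨w ++ [s], by simp, by simpa [demazureWord] using hw⟩

include H in
/-- Homogeneous elements which are linearly independent modulo `posIdeal` are linearly independent
over the invariants. -/
theorem linearIndependent_of_homogeneous [Finite G] {κ : Type*} {f : κ → R} {deg : κ → ℕ}
    (hf : ∀ k, f k ∈ 𝓡 (deg k))
    (hli : LinearIndependent ℂ fun k => Ideal.Quotient.mkₐ ℂ (posIdeal 𝓡 A) (f k)) :
    LinearIndependent A f := by
  classical
  rw [linearIndependent_iff']
  intro t a ha
  by_contra! hne
  -- A word of length `deg i₀` kills the `f k` of lower degree and makes those of equal degree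
  -- constant; higher degrees have coefficient 0 by maximality. Applied to the relation, it leaves a
  -- ℂ-linear relation among the `a k`.
  obtain ⟨i₀, hi₀, hmax⟩ := (t.filter (a · ≠ 0)).exists_max_image deg
    (by obtain ⟨i, hi, hi'⟩ := hne; exact ⟨i, by simp [hi, hi']⟩)
  rw [Finset.mem_filter] at hi₀
  -- Independence modulo J concerns complex coefficients, so the elements `a k` of A are replaced by
  -- their values under a functional.
  obtain ⟨ψ, hψ⟩ : ∃ ψ : Module.Dual ℂ R, ψ (a i₀) ≠ 0 := by
    by_contra! hψ
    exact hi₀.2 (Subtype.ext ((Module.forall_dual_apply_eq_zero_iff ℂ _).1 hψ))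
  refine hψ (eq_zero_of_sum_mem_posIdeal hli (t.filter (deg · = deg i₀)) (fun k => ψ (a k)) ?_ i₀
    (by simp [hi₀.1]))
  by_contra hJ
  obtain ⟨w, hw, hwJ⟩ := H.exists_word (d := deg i₀) (sum_mem fun k hk => by
    rw [← (Finset.mem_filter.1 hk).2]; exact Submodule.smul_mem _ _ (hf k)) hJ
  -- The value 0 in other degrees only makes c a total function.
  have hconst : ∀ k, ∃ c : ℂ, deg k = deg i₀ → algebraMap ℂ R c = H.demazureWord w (f k) := by
    intro k
    by_cases hk : deg k = deg i₀
    · obtain ⟨c, hc⟩ := H.deg_zero _ (H.demazureWord_mem (by omega) (hf k) (n := 0) (w := w))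
      exact ⟨c, fun _ => hc⟩
    · exact ⟨0, fun h => absurd h hk⟩
  choose c hc using hconst
  have h0 : ∑ k ∈ t.filter (deg · = deg i₀), (a k : R) * algebraMap ℂ R (c k) = 0 := by
    have h1 := congrArg (H.demazureWord w) ha
    rw [map_sum, map_zero] at h1
    rw [← h1, Finset.sum_filter]
    refine Finset.sum_congr rfl fun k hk => ?_
    rw [map_smul]
    split_ifs with h
    · rw [hc k h]; rfl
    · rcases lt_or_gt_of_ne h with h | h
      · rw [H.demazureWord_eq_zero (by omega) (hf k), smul_zero]
      · have : a k = 0 := by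
          by_contra hk'
          have := hmax k (by simp [hk, hk'])
          omega
        rw [this, zero_smul]
  have h2 := congrArg ψ h0
  simp only [mul_comm _ (algebraMap ℂ R _), ← Algebra.smul_def, map_sum, map_smul, map_zero,
    smul_eq_mul] at h2
  apply hwJ
  convert zero_mem (posIdeal 𝓡 A)
  rw [← LinearMap.coe_restrictScalars ℂ, map_sum, ← map_zero (algebraMap ℂ R), ← h2, map_sum]
  refine Finset.sum_congr rfl fun k hk => ?_
  rw [map_smul, LinearMap.coe_restrictScalars, ← hc k (Finset.mem_filter.1 hk).2,
    Algebra.smul_def, ← map_mul, mul_comm]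

end GradedReflectionAction
end

/-! ### The rank, the socle of R/J and the Frobenius form. -/

noncomputable section

set_option linter.unusedSectionVars false
namespace GradedReflectionAction

variable {R : Type*} [CommRing R] [IsDomain R] [Algebra ℂ R] {G : Type*} [Group G]
  [MulSemiringAction G R] {𝓡 : ℕ → Submodule ℂ R} [GradedAlgebra 𝓡]
  {A : Subalgebra ℂ R} {S : Type*} (H : GradedReflectionAction G 𝓡 A S)

include H in
theorem isGaloisGroup [FaithfulSMul G R] : IsGaloisGroup G A R where
  faithful := inferInstance
  commutes := ⟨fun g a x => H.smul_mul_of_mem g a.2 x⟩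
  isInvariant := ⟨fun x hx => ⟨⟨x, (H.mem_iff x).2 hx⟩, rfl⟩⟩

include H in
/-- The ring is free over the invariants, of rank the order of the group. -/
theorem exists_homogeneous_basis [Finite G] [FaithfulSMul G R] :
    ∃ (b : Module.Basis (Fin (Nat.card G)) A R) (deg : Fin (Nat.card G) → ℕ),
      (∀ k, b k ∈ 𝓡 (deg k)) ∧
      (LinearIndependent ℂ fun k => Ideal.Quotient.mkₐ ℂ (posIdeal 𝓡 A) (b k)) ∧
      ∀ x, ∃ y ∈ Submodule.span ℂ (Set.range b), x - y ∈ posIdeal 𝓡 A := by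
  classical
  obtain ⟨κ, a, -, hspan, hli⟩ := exists_linearIndependent' ℂ
    (fun x : Σ d, 𝓡 d => Ideal.Quotient.mkₐ ℂ (posIdeal 𝓡 A) (x.2 : R))
  have hs : ∀ x, ∃ y ∈ Submodule.span ℂ (Set.range fun k => ((a k).2 : R)),
      x - y ∈ posIdeal 𝓡 A := by
    intro x
    have hx : Ideal.Quotient.mkₐ ℂ (posIdeal 𝓡 A) x ∈
        Submodule.span ℂ (Set.range ((fun x : Σ d, 𝓡 d =>
          Ideal.Quotient.mkₐ ℂ (posIdeal 𝓡 A) (x.2 : R)) ∘ a)) := by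
      rw [hspan, ← DirectSum.sum_support_decompose 𝓡 x, map_sum]
      exact sum_mem fun d _ => Submodule.subset_span ⟨⟨d, DirectSum.decompose 𝓡 x d⟩, rfl⟩
    have he : Set.range ((fun x : Σ d, 𝓡 d => Ideal.Quotient.mkₐ ℂ (posIdeal 𝓡 A) (x.2 : R)) ∘ a) =
        (Ideal.Quotient.mkₐ ℂ (posIdeal 𝓡 A)).toLinearMap '' Set.range fun k => ((a k).2 : R) := by
      rw [← Set.range_comp]; rfl
    rw [he, ← Submodule.map_span] at hx
    obtain ⟨y, hy, hxy⟩ := hx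
    exact ⟨y, hy, Ideal.Quotient.eq.1 hxy.symm⟩
  have hf : ∀ k, ((a k).2 : R) ∈ 𝓡 (a k).1 := fun k => (a k).2.2
  let b₀ : Module.Basis κ A R := Module.Basis.mk (H.linearIndependent_of_homogeneous hf hli)
    (span_eq_top_of_homogeneous hf hs).ge
  have := H.isGaloisGroup
  -- Galois theory computes the rank. Finiteness of κ is deduced from it, since the order of G is
  -- not 0.
  have hcard : Nat.card κ = Nat.card G := by
    rw [IsGaloisGroup.card_eq_finrank' G A R, Module.finrank_eq_nat_card_basis b₀]
  have : Finite κ := Nat.finite_of_card_ne_zero (hcard ▸ Nat.card_pos.ne')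
  let e : κ ≃ Fin (Nat.card G) := (Finite.equivFin κ).trans (finCongr hcard)
  have hb : ⇑(b₀.reindex e) = (fun k => ((a k).2 : R)) ∘ e.symm := by
    ext k; simp [b₀]
  refine ⟨b₀.reindex e, fun k => (a (e.symm k)).1, fun k => ?_, ?_, ?_⟩
  · rw [hb]; exact hf _
  · rw [hb]; exact hli.comp _ e.symm.injective
  · rw [hb, e.symm.surjective.range_comp]; exact hs

include H in
/-- Homogeneous skew elements are proportional modulo `posIdeal`. -/
theorem sub_smul_mem_posIdeal_of_skew [Finite G] {d e : ℕ} {f u : R} (hf : f ∈ 𝓡 d) (hu : u ∈ 𝓡 e)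
    (hfs : ∀ g : G, g • f = (H.sign g : ℤ) • f) (hus : ∀ g : G, g • u = (H.sign g : ℤ) • u)
    (h : u ∉ posIdeal 𝓡 A) : ∃ c : ℂ, f - c • u ∈ posIdeal 𝓡 A := by
  have hu' : ∀ u : ℤˣ, (u : ℤ) * u = 1 := fun u => by
    rcases Int.units_eq_one_or u with rfl | rfl <;> rfl
  have hA : ∀ x y : R, (∀ g : G, g • x = (H.sign g : ℤ) • x) →
      (∀ g : G, g • y = (H.sign g : ℤ) • y) → x * y ∈ A := fun x y hx hy =>
    (H.mem_iff _).2 fun g => by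
      rw [smul_mul', hx, hy, smul_mul_smul_comm, hu', one_smul]
  -- Otherwise f and u are independent modulo J, hence over A. But products of two skew elements are
  -- invariant, so u² · f - (f u) · u = 0 is a relation over A, which forces u = 0.
  by_contra! hc
  have hli : LinearIndependent A ![f, u] := by
    refine H.linearIndependent_of_homogeneous (deg := ![d, e]) (by simp [Fin.forall_fin_two, *]) ?_
    have he : (fun k => Ideal.Quotient.mkₐ ℂ (posIdeal 𝓡 A) (![f, u] k)) =
        ![Ideal.Quotient.mkₐ ℂ (posIdeal 𝓡 A) f, Ideal.Quotient.mkₐ ℂ (posIdeal 𝓡 A) u] := by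
      ext k; fin_cases k <;> rfl
    rw [he, LinearIndependent.pair_iff]
    intro s t hst
    rw [← map_smul, ← map_smul, ← map_add, Ideal.Quotient.mkₐ_eq_mk,
      Ideal.Quotient.eq_zero_iff_mem] at hst
    have hs : s = 0 := by
      by_contra hs
      apply hc (-(s⁻¹ * t))
      have := posIdeal_smul_mem s⁻¹ hst
      simpa [smul_smul, hs] using this
    refine ⟨hs, ?_⟩
    by_contra ht
    rw [hs, zero_smul, zero_add, posIdeal_smul_mem_iff ht] at hst
    exact h hst
  have h2 := LinearIndependent.pair_iff.1 hli ⟨u * u, hA u u hus hus⟩ (-⟨f * u, hA f u hfs hus⟩) (by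
    rw [neg_smul]
    change u * u * f + -(f * u * u) = 0
    ring)
  have h3 : u * u = 0 := congrArg Subtype.val h2.1
  rw [mul_self_eq_zero.1 h3] at h
  exact h (zero_mem _)

/-- Elements killed by the roots modulo `posIdeal` are skew modulo `posIdeal`. -/
theorem exists_skew [Finite G] {d : ℕ} {f : R} (hf : f ∈ 𝓡 d)
    (h : ∀ s, H.root s * f ∈ posIdeal 𝓡 A) :
    ∃ f' ∈ 𝓡 d, f - f' ∈ posIdeal 𝓡 A ∧ ∀ g : G, g • f' = (H.sign g : ℤ) • f' := by
  refine H.exists_semiinvariant H.sign hf fun s => ?_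
  -- As ∂_s preserves J, this puts f + s f in J, which is skewness modulo J.
  have h1 : H.demazure s (H.root s * f) = f + H.refl s • f := by
    refine mul_left_cancel₀ (H.root_ne_zero s) ?_
    rw [root_mul_demazure, smul_mul', refl_root]
    ring
  simpa [H.sign_refl, ← h1] using map_mem_posIdeal (H.demazure s) (h s)

/-- The socle of `R` modulo `posIdeal` is spanned by a skew element `u`. -/
theorem exists_mul_sub_smul_mem [Finite G] {N : ℕ} (hN : ∀ m > N, ∀ x ∈ 𝓡 m, x ∈ posIdeal 𝓡 A)
    {u : R} (hu : u ∈ 𝓡 N) (hus : ∀ g : G, g • u = (H.sign g : ℤ) • u) (huJ : u ∉ posIdeal 𝓡 A)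
    {d e : ℕ} (hde : N = d + e) {f : R} (hf : f ∈ 𝓡 d) (hfJ : f ∉ posIdeal 𝓡 A) :
    ∃ h ∈ 𝓡 e, ∃ c : ℂ, c ≠ 0 ∧ f * h - c • u ∈ posIdeal 𝓡 A := by
  -- When all roots kill f modulo J, f is a multiple of u modulo J, and comparing degrees forces d =
  -- N. Otherwise the induction below multiplies f by a root that keeps it outside J, one degree
  -- closer to N.
  have hend : ∀ {d e : ℕ} {f : R}, N = d + e → f ∈ 𝓡 d → f ∉ posIdeal 𝓡 A → (∀ s, H.root s * f ∈ posIdeal 𝓡 A) →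
      ∃ h ∈ 𝓡 e, ∃ c : ℂ, c ≠ 0 ∧ f * h - c • u ∈ posIdeal 𝓡 A := by
    intro d e f hde hf hfJ hall
    obtain ⟨f', hf', hff', hsk⟩ := H.exists_skew hf hall
    obtain ⟨c, hc⟩ := H.sub_smul_mem_posIdeal_of_skew hf' hu hsk hus huJ
    have hfc : f - c • u ∈ posIdeal 𝓡 A := by simpa using add_mem hff' hc
    rcases Nat.eq_zero_or_pos e with rfl | he
    · refine ⟨1, SetLike.GradedOne.one_mem, c, ?_, by simpa using hfc⟩
      rintro rfl
      exact hfJ (by simpa using hfc)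
    · refine absurd ?_ hfJ
      have h1 := decompose_mem_posIdeal hfc d
      rwa [DirectSum.decompose_sub, DirectSum.sub_apply, Submodule.coe_sub,
        DirectSum.decompose_of_mem_same 𝓡 hf,
        DirectSum.decompose_of_mem_ne 𝓡 (Submodule.smul_mem _ c hu) (by omega), sub_zero] at h1
  induction e generalizing d f with
  | zero =>
    exact hend hde hf hfJ fun s => hN (1 + d) (by omega) _ (SetLike.mul_mem_graded (H.root_mem s) hf)
  | succ e ih =>
    by_cases hall : ∀ s, H.root s * f ∈ posIdeal 𝓡 A
    · exact hend hde hf hfJ hall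
    · obtain ⟨s, hs⟩ := not_forall.1 hall
      obtain ⟨h, hh, c, hc, hcJ⟩ := ih (by omega : N = (1 + d) + e)
        (SetLike.mul_mem_graded (H.root_mem s) hf) hs
      refine ⟨H.root s * h, add_comm 1 e ▸ SetLike.mul_mem_graded (H.root_mem s) hh, c, hc, ?_⟩
      rwa [← mul_assoc, mul_comm f]

/-- A word whose composite of Demazure operators is a Frobenius form on `R` modulo `posIdeal`. -/
theorem exists_frobenius_word [Finite G] {κ : Type*} [Finite κ] {f : κ → R} {deg : κ → ℕ}
    (hf : ∀ k, f k ∈ 𝓡 (deg k))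
    (hli : LinearIndependent ℂ fun k => Ideal.Quotient.mkₐ ℂ (posIdeal 𝓡 A) (f k))
    (hs : ∀ x, ∃ y ∈ Submodule.span ℂ (Set.range f), x - y ∈ posIdeal 𝓡 A) :
    ∃ w : List S, (∀ k, deg k ≤ w.length) ∧ (∀ x, H.demazureWord w x ∈ A) ∧
      ∀ d, ∀ x ∈ 𝓡 d, x ∉ posIdeal 𝓡 A →
        ∃ h ∈ 𝓡 (w.length - d), d ≤ w.length ∧ H.demazureWord w (x * h) ≠ 0 := by
  have : Nonempty κ := by
    by_contra hκ
    rw [not_nonempty_iff] at hκ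
    obtain ⟨y, hy, h1⟩ := hs 1
    rw [Set.range_eq_empty, Submodule.span_empty, Submodule.mem_bot] at hy
    exact one_notMem_posIdeal (by simpa [hy] using h1)
  -- The largest basis degree is the top degree of R/J. There every root kills `f k₀` for degree
  -- reasons, so `f k₀` is congruent to a skew u; a word not killing u modulo J will be the form.
  obtain ⟨k₀, hk₀⟩ := Finite.exists_max deg
  have hN : ∀ m > deg k₀, ∀ x ∈ 𝓡 m, x ∈ posIdeal 𝓡 A := by
    intro m hm x hx
    obtain ⟨y, hy, hxy⟩ := hs x
    have h2 : (DirectSum.decompose 𝓡 y m : R) = 0 := by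
      clear hxy
      induction hy using Submodule.span_induction with
      | mem y hy =>
        obtain ⟨k, rfl⟩ := hy
        exact DirectSum.decompose_of_mem_ne 𝓡 (hf k) (by have := hk₀ k; omega)
      | zero => simp
      | add x y _ _ hx hy => simp [hx, hy]
      | smul c x _ hx =>
        rw [DirectSum.decompose_smul]
        change c • (DirectSum.decompose 𝓡 x m : R) = 0
        rw [hx, smul_zero]
    have h1 := decompose_mem_posIdeal hxy m
    rwa [DirectSum.decompose_sub, DirectSum.sub_apply, Submodule.coe_sub,
      DirectSum.decompose_of_mem_same 𝓡 hx, h2, sub_zero] at h1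
  have hk₀J : f k₀ ∉ posIdeal 𝓡 A := fun h =>
    hli.ne_zero k₀ (Ideal.Quotient.eq_zero_iff_mem.2 h)
  obtain ⟨u, hu, hfu, hus⟩ := H.exists_skew (hf k₀) fun s =>
    hN (1 + deg k₀) (by omega) _ (SetLike.mul_mem_graded (H.root_mem s) (hf k₀))
  have huJ : u ∉ posIdeal 𝓡 A := fun h => hk₀J (by simpa using add_mem hfu h)
  obtain ⟨w, hw, hwu⟩ := H.exists_word hu huJ
  have hspan := span_eq_top_of_homogeneous hf hs
  refine ⟨w, fun k => hw ▸ hk₀ k, fun x => ?_, fun d x hx hxJ => ?_⟩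
  · have h0 : ∀ s, H.refl s • H.demazureWord w x = H.demazureWord w x := by
      intro s
      rw [← demazure_eq_zero_iff, ← demazureWord_cons]
      refine LinearMap.congr_fun (g := 0) (LinearMap.ext_on_range hspan fun k => ?_) x
      exact H.demazureWord_eq_zero (by have := hk₀ k; simp; omega) (hf k)
    refine (H.mem_iff _).2 fun g => ?_
    have hg : g ∈ Subgroup.closure (Set.range H.refl) := H.closure_refl ▸ Subgroup.mem_top g
    induction hg using Subgroup.closure_induction with
    | mem g hg => obtain ⟨s, rfl⟩ := hg; exact h0 s
    | one => simp
    | mul a b _ _ ha hb => rw [mul_smul, hb, ha]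
    | inv a _ ha => rw [inv_smul_eq_iff, ha]
  · have hd : d ≤ w.length := by
      by_contra hd
      exact hxJ (hN d (by omega) x hx)
    obtain ⟨h, hh, c, hc, hcJ⟩ := H.exists_mul_sub_smul_mem hN hu hus huJ
      (by omega : deg k₀ = d + (w.length - d)) hx hxJ
    refine ⟨h, hh, hd, fun h0 => hwu ?_⟩
    have h1 := map_mem_posIdeal (H.demazureWord w) hcJ
    rw [map_sub, h0, zero_sub, neg_mem_iff, ← LinearMap.coe_restrictScalars ℂ, map_smul] at h1
    exact (posIdeal_smul_mem_iff hc).1 h1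

/-- The Frobenius form of a word has homogeneous dual bases. -/
theorem exists_dual_basis [Finite G] {κ : Type*} [Finite κ] [DecidableEq κ] {f : κ → R}
    {deg : κ → ℕ} (hf : ∀ k, f k ∈ 𝓡 (deg k))
    (hli : LinearIndependent ℂ fun k => Ideal.Quotient.mkₐ ℂ (posIdeal 𝓡 A) (f k))
    {w : List S} (hdeg : ∀ k, deg k ≤ w.length) (hwA : ∀ x, H.demazureWord w x ∈ A)
    (hw : ∀ d, ∀ x ∈ 𝓡 d, x ∉ posIdeal 𝓡 A →
        ∃ h ∈ 𝓡 (w.length - d), d ≤ w.length ∧ H.demazureWord w (x * h) ≠ 0) (k : κ) :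
    ∃ g ∈ 𝓡 (w.length - deg k), ∀ i, H.demazureWord w (f i * g) = if i = k then 1 else 0 := by
  have := Fintype.ofFinite κ
  set T := H.demazureWord w
  have hinj : LinearMap.ker (Algebra.linearMap ℂ R) = ⊥ :=
    LinearMap.ker_eq_bot.2 (algebraMap ℂ R).injective
  -- Any linear retraction of ℂ → R will do: it only reads constants of R as complex numbers.
  obtain ⟨ε, hε⟩ := LinearMap.exists_leftInverse_of_injective (Algebra.linearMap ℂ R) hinj
  replace hε : ∀ c, ε (algebraMap ℂ R c) = c := LinearMap.congr_fun hε
  have hpair : ∀ {d : ℕ} {x h : R}, d ≤ w.length → x ∈ 𝓡 d → h ∈ 𝓡 (w.length - d) →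
      T (x * h) = algebraMap ℂ R (ε (T (x * h))) := fun {d x h} hd hx hh => by
    obtain ⟨c, hc⟩ := H.deg_zero _ (H.demazureWord_mem (n := 0) (w := w) (by omega)
      (SetLike.mul_mem_graded hx hh))
    rw [← hc, hε]
  -- Duality inside one degree. If the pairing map Φ were not onto, a nonzero functional vanishing
  -- on its range would give a combination of the `f i` that pairs to 0 with the complementary
  -- degree. It would lie in J, against independence.
  have hstep : ∀ k, ∃ h ∈ 𝓡 (w.length - deg k), ∀ i, deg i = deg k →
      T (f i * h) = if i = k then 1 else 0 := by
    intro k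
    let Φ : 𝓡 (w.length - deg k) →ₗ[ℂ] ({i // deg i = deg k} → ℂ) := LinearMap.pi fun i =>
      ε ∘ₗ T.restrictScalars ℂ ∘ₗ LinearMap.mulLeft ℂ (f i) ∘ₗ Submodule.subtype _
    have hΦ : LinearMap.range Φ = ⊤ := by
      by_contra hne
      obtain ⟨φ, hφ0, hφ⟩ := Submodule.exists_le_ker_of_lt_top _ (lt_top_iff_ne_top.2 hne)
      apply hφ0
      set c : {i // deg i = deg k} → ℂ := fun i => φ (Pi.single i 1)
      have hφc : ∀ v, φ v = ∑ i, v i * c i := fun v => by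
        rw [LinearMap.pi_apply_eq_sum_univ φ v]
        refine Finset.sum_congr rfl fun i _ => ?_
        rw [smul_eq_mul]
        congr 2
        ext j
        simp [Pi.single_apply, eq_comm]
      have hx : ∑ i : {i // deg i = deg k}, c i • f i ∈ 𝓡 (deg k) :=
        sum_mem fun i _ => Submodule.smul_mem _ _ (by have := hf i; rwa [i.2] at this)
      have hJ : ∑ i : {i // deg i = deg k}, c i • f i ∈ posIdeal 𝓡 A := by
        by_contra hJ
        obtain ⟨h, hh, hd, hne⟩ := hw _ _ hx hJ
        refine hne ?_
        rw [hpair hd hx hh]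
        have h1 : φ (Φ ⟨h, hh⟩) = 0 := hφ (LinearMap.mem_range_self _ _)
        rw [hφc] at h1
        rw [← map_zero (algebraMap ℂ R), ← h1, Finset.sum_mul, map_sum, map_sum]
        congr 1
        refine Finset.sum_congr rfl fun i _ => ?_
        rw [smul_mul_assoc, LinearMap.map_smul_of_tower, map_smul, smul_eq_mul, mul_comm]
        rfl
      have hc0 := eq_zero_of_sum_mem_posIdeal (hli.comp _ Subtype.val_injective)
        Finset.univ c hJ
      refine LinearMap.ext fun v => ?_
      rw [hφc]
      exact Finset.sum_eq_zero fun i hi => by rw [hc0 i hi, mul_zero]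
    obtain ⟨h, hh⟩ := LinearMap.range_eq_top.1 hΦ (Pi.single ⟨k, rfl⟩ 1)
    refine ⟨h, h.2, fun i hi => ?_⟩
    rw [hpair (hdeg k) (hi ▸ hf i) h.2]
    have h2 : ε (T (f i * h)) = _ := congrFun hh ⟨i, hi⟩
    rw [h2, Pi.single_apply]
    simp only [Subtype.mk.injEq]
    split_ifs <;> simp
  -- Descending induction on the degree of `f k`. The h from `hstep` pairs correctly with the `f i`
  -- of degree at most `deg k`; for larger degrees the value T(f_i h) ∈ A is removed by subtracting
  -- T(f_i h) g_i, with g_i already dual.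
  induction hm : w.length - deg k using Nat.strong_induction_on generalizing k with
  | _ m ih =>
    obtain ⟨h, hh, hhT⟩ := hstep k
    have hex : ∀ i, ∃ g, deg k < deg i → g ∈ 𝓡 (w.length - deg i) ∧
        ∀ j, T (f j * g) = if j = i then 1 else 0 := by
      intro i
      by_cases hi : deg k < deg i
      · obtain ⟨g, hg, hg'⟩ := ih (w.length - deg i) (by have := hdeg i; omega) i rfl
        exact ⟨g, fun _ => ⟨hg, hg'⟩⟩
      · exact ⟨0, fun h => absurd h hi⟩
    choose g hg using hex
    refine ⟨h - ∑ i with deg k < deg i, T (f i * h) * g i, ?_, fun j => ?_⟩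
    · rw [← hm]
      refine sub_mem hh (sum_mem fun i hi => ?_)
      have hi := (Finset.mem_filter.1 hi).2
      have h1 := SetLike.mul_mem_graded (H.demazureWord_mem (n := deg i - deg k) (w := w)
        (by have := hdeg i; omega) (SetLike.mul_mem_graded (hf i) hh)) (hg i hi).1
      rwa [show deg i - deg k + (w.length - deg i) = w.length - deg k by
        have := hdeg i; omega] at h1
    · have h1 : ∀ i ∈ Finset.univ.filter (deg k < deg ·),
          T (f j * (T (f i * h) * g i)) = if j = i then T (f j * h) else 0 := by
        intro i hi
        rw [mul_left_comm]
        have h2 := T.map_smul ⟨_, hwA (f i * h)⟩ (f j * g i)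
        rw [Subalgebra.smul_def, Subalgebra.smul_def, (hg i (Finset.mem_filter.1 hi).2).2 j] at h2
        refine h2.trans ?_
        split_ifs with hji
        · subst hji; exact mul_one _
        · exact mul_zero _
      rw [mul_sub, map_sub, Finset.mul_sum, map_sum, Finset.sum_congr rfl h1, Finset.sum_ite_eq]
      simp only [Finset.mem_filter, Finset.mem_univ, true_and]
      rcases lt_trichotomy (deg j) (deg k) with hj | hj | hj
      · rw [if_neg (by omega), if_neg (by rintro rfl; omega), sub_zero]
        exact H.demazureWord_eq_zero (by have := hdeg k; omega) (SetLike.mul_mem_graded (hf j) hh)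
      · rw [if_neg (by omega), sub_zero, hhT j hj]
      · rw [if_pos hj, if_neg (by rintro rfl; omega), sub_self]

include H in
/-- The ring is a free Frobenius extension of the invariants, with form a composite of Demazure
operators. -/
theorem exists_frobenius [Finite G] [FaithfulSMul G R] :
    ∃ (w : List S) (b : Module.Basis (Fin (Nat.card G)) A R) (b' : Fin (Nat.card G) → R)
      (deg : Fin (Nat.card G) → ℕ), (∀ k, b k ∈ 𝓡 (deg k)) ∧ (∀ k, deg k ≤ w.length) ∧
      (∀ k, b' k ∈ 𝓡 (w.length - deg k)) ∧ (∀ x, H.demazureWord w x ∈ A) ∧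
      ∀ i k, H.demazureWord w (b i * b' k) = if i = k then 1 else 0 := by
  obtain ⟨b, deg, hb, hli, hs⟩ := H.exists_homogeneous_basis
  obtain ⟨w, hdeg, hwA, hw⟩ := H.exists_frobenius_word hb hli hs
  choose b' hb' hbb' using H.exists_dual_basis hb hli hdeg hwA hw
  exact ⟨w, b, b', deg, hb, hdeg, hb', hwA, fun i k => hbb' k i⟩

end GradedReflectionAction
end

noncomputable section

/-! ### The symmetric algebra of a realization -/

namespace SymmetricAlgebra

variable {K : Type*} [Field K] {M : Type*} [AddCommGroup M] [Module K M]

/-- Both sides are n-th powers of their degree-one parts, and in degree one the basis corresponds to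
the variables. -/
theorem map_equivMvPolynomial_range_ι_pow {κ : Type*} (b : Module.Basis κ K M) (n : ℕ) :
    (LinearMap.range (ι K M) ^ n).map (equivMvPolynomial b).toLinearMap =
      MvPolynomial.homogeneousSubmodule κ K n := by
  have h1 : (LinearMap.range (ι K M)).map (equivMvPolynomial b).toAlgHom.toLinearMap =
      MvPolynomial.homogeneousSubmodule κ K 1 := by
    rw [MvPolynomial.homogeneousSubmodule_one_eq_span_X, LinearMap.range_eq_map, ← b.span_eq,
      Submodule.map_span, Submodule.map_span, ← Set.range_comp, ← Set.range_comp]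
    congr 2
    ext k : 1
    exact equivMvPolynomial_ι_apply b k
  rw [← MvPolynomial.homogeneousSubmodule_one_pow, ← h1, ← Submodule.map_pow]
  rfl

variable (K M) in
/-- The grading of the symmetric algebra by degree. -/
abbrev grading (n : ℕ) : Submodule K (SymmetricAlgebra K M) := LinearMap.range (ι K M) ^ n

theorem isInternal_grading : DirectSum.IsInternal (grading K M) := by
  let b := Module.Basis.ofVectorSpace K M
  let e := (equivMvPolynomial b).toLinearEquiv
  let := MvPolynomial.gradedAlgebra (σ := Module.Basis.ofVectorSpaceIndex K M) (R := K)
  have hi := DirectSum.Decomposition.isInternal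
    (MvPolynomial.homogeneousSubmodule (Module.Basis.ofVectorSpaceIndex K M) K)
  rw [DirectSum.isInternal_submodule_iff_iSupIndep_and_iSup_eq_top] at hi ⊢
  have he : MvPolynomial.homogeneousSubmodule (Module.Basis.ofVectorSpaceIndex K M) K =
      Submodule.orderIsoMapComap e ∘ grading K M :=
    funext fun n => (map_equivMvPolynomial_range_ι_pow b n).symm
  rw [he, iSupIndep_map_orderIso_iff] at hi
  refine ⟨hi.1, (Submodule.orderIsoMapComap e).injective ?_⟩
  rw [OrderIso.map_iSup, OrderIso.map_top]
  exact hi.2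

instance gradedAlgebra : GradedAlgebra (grading K M) where
  one_mem := by simp [grading]
  mul_mem i j x y hx hy := by
    rw [grading, pow_add]; exact Submodule.mul_mem_mul hx hy
  toDecomposition := isInternal_grading.chooseDecomposition

theorem ι_injective : Function.Injective (ι K M) := by
  let b := Module.Basis.ofVectorSpace K M
  have h : (equivMvPolynomial b).toLinearMap ∘ₗ ι K M = b.constr K MvPolynomial.X :=
    b.ext fun k => by simp
  have h2 : Function.Injective (b.constr K (MvPolynomial.X (R := K))) := by
    have h3 : ⇑(b.constr K (MvPolynomial.X (R := K))) =
        Finsupp.linearCombination K MvPolynomial.X ∘ b.repr := by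
      ext1 m
      rw [Module.Basis.constr_apply, Function.comp_apply, Finsupp.linearCombination_apply]
    rw [h3]
    have h4 : Function.Injective (Finsupp.linearCombination K (MvPolynomial.X (R := K)
        (σ := Module.Basis.ofVectorSpaceIndex K M))) :=
      MvPolynomial.linearIndependent_X _ K
    exact h4.comp b.repr.injective
  exact Function.Injective.of_comp (f := equivMvPolynomial b) (by
    rw [← h] at h2; exact h2)

end SymmetricAlgebra

/-! ### The action of W_I on Sym(V*). -/

namespace Realization

universe u
variable {B W : Type*} [Group W] {M : CoxeterMatrix B} {cs : CoxeterSystem M W} {V : Type u}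
  [AddCommGroup V] [Module ℂ V] (h : Realization cs V)

theorem act_ι (w : W) (f : Module.Dual ℂ V) :
    h.act w (SymmetricAlgebra.ι ℂ _ f) = SymmetricAlgebra.ι ℂ _ (h.rep.dual w f) := by
  simp [act]

theorem act_one : h.act 1 = AlgHom.id ℂ _ :=
  SymmetricAlgebra.algHom_ext (LinearMap.ext fun f => (h.act_ι 1 f).trans (by rw [map_one]; rfl))

theorem act_mul (v w : W) : h.act (v * w) = (h.act v).comp (h.act w) :=
  SymmetricAlgebra.algHom_ext (LinearMap.ext fun f => (h.act_ι _ f).trans (by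
    refine Eq.trans ?_ (congrArg (h.act v) (h.act_ι w f)).symm
    rw [act_ι, map_mul]
    rfl))

/-- The action of a subgroup of `W` on `R`. -/
abbrev polyAction (H : Subgroup W) : MulSemiringAction H h.polyRing where
  smul w f := h.act w f
  one_smul f := congr($(h.act_one) f)
  mul_smul v w f := congr($(h.act_mul v w) f)
  smul_zero w := map_zero (h.act w)
  smul_add w := map_add (h.act w)
  smul_one w := map_one (h.act w)
  smul_mul w := map_mul (h.act w)

theorem dual_simple (s : B) (f : Module.Dual ℂ V) :
    h.rep.dual (cs.simple s) f = f - f (h.coroot s) • h.root s := by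
  ext v
  rw [Representation.dual_apply, cs.inv_simple, Module.Dual.transpose_apply, LinearMap.comp_apply,
    h.rep_simple]
  simp [mul_comm]

theorem root_ne_zero (s : B) : h.root s ≠ 0 := fun h0 => by
  have := h.root_coroot_self s
  simp [h0] at this

theorem act_mem_grading (w : W) {n : ℕ} {x : h.polyRing}
    (hx : x ∈ SymmetricAlgebra.grading ℂ (Module.Dual ℂ V) n) :
    h.act w x ∈ SymmetricAlgebra.grading ℂ (Module.Dual ℂ V) n := by
  have h1 : (SymmetricAlgebra.grading ℂ (Module.Dual ℂ V) n).map (h.act w).toLinearMap ≤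
      SymmetricAlgebra.grading ℂ (Module.Dual ℂ V) n := by
    rw [SymmetricAlgebra.grading, Submodule.map_pow]
    refine pow_le_pow_left' ?_ n
    rintro _ ⟨_, ⟨f, rfl⟩, rfl⟩
    exact ⟨_, (h.act_ι w f).symm⟩
  exact h1 ⟨x, hx, rfl⟩

/-- On a linear form f the difference is f(α_s^∨) α_s. The twisted Leibniz rule x y - s(x) s(y) = (x
- s x) y + s(x) (y - s y) carries divisibility to products. -/
theorem root_dvd (s : B) (x : h.polyRing) :
    SymmetricAlgebra.ι ℂ _ (h.root s) ∣ x - h.act (cs.simple s) x := by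
  induction x using SymmetricAlgebra.induction with
  | algebraMap c => simp
  | ι f => rw [act_ι, dual_simple, map_sub, sub_sub_cancel, map_smul]; exact dvd_smul_of_dvd _ dvd_rfl
  | mul x y hx hy =>
    rw [map_mul, show x * y - h.act (cs.simple s) x * h.act (cs.simple s) y =
      (x - h.act (cs.simple s) x) * y +
        h.act (cs.simple s) x * (y - h.act (cs.simple s) y) by ring]
    exact dvd_add (hx.mul_right _) (hy.mul_left _)
  | add x y hx hy =>
    rw [map_add, add_sub_add_comm]
    exact dvd_add hx hy

/-- The action of a parabolic subgroup on `R` as a group generated by reflections. -/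
def reflectionAction (I : Set B) :
    letI := h.polyAction (parabolic cs I)
    GradedReflectionAction (parabolic cs I) (SymmetricAlgebra.grading ℂ (Module.Dual ℂ V))
      (h.invariants (parabolic cs I)) I :=
  letI := h.polyAction (parabolic cs I)
  { mem_iff := fun x => ⟨fun hx g => hx g g.2, fun hx g hg => hx ⟨g, hg⟩⟩
    smul_mem := fun g _ _ hx => h.act_mem_grading g hx
    deg_zero := fun x hx => by
      rw [SymmetricAlgebra.grading, pow_zero] at hx
      exact Submodule.mem_one.1 hx
    refl := fun s => ⟨cs.simple s, Subgroup.subset_closure ⟨s, s.2, rfl⟩⟩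
    refl_mul_self := fun s => Subtype.ext (cs.simple_mul_simple_self s)
    closure_refl := by
      have h1 : Set.range (fun s : I => (⟨cs.simple s, Subgroup.subset_closure ⟨s, s.2, rfl⟩⟩ :
          parabolic cs I)) = Subtype.val ⁻¹' (cs.simple '' I) := by
        ext x
        constructor
        · rintro ⟨s, rfl⟩
          exact ⟨s, s.2, rfl⟩
        · rintro ⟨s, hs, h⟩
          exact ⟨⟨s, hs⟩, Subtype.ext h⟩
      rw [h1]
      exact Subgroup.closure_closure_coe_preimage
    root := fun s => SymmetricAlgebra.ι ℂ _ (h.root s)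
    root_ne_zero := fun s h0 => h.root_ne_zero s (SymmetricAlgebra.ι_injective (by simpa using h0))
    root_mem := fun s => by rw [SymmetricAlgebra.grading, pow_one]; exact ⟨_, rfl⟩
    refl_root := fun s => by
      refine (h.act_ι _ _).trans ?_
      rw [dual_simple, root_coroot_self, two_smul, sub_add_cancel_left, map_neg]
    dvd := fun s x => h.root_dvd s x
    -- Every relation (s t)^m has even length, so sending all simple reflections to -1 is
    -- consistent.
    sign := (cs.lift ⟨fun _ => (-1 : ℤˣ), fun _ _ => by simp⟩).comp (Subgroup.subtype _)
    sign_refl := fun s => cs.lift_apply_simple _ _ }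

/-- On linear forms g acts by the transpose of g⁻¹, and linear forms separate the points of V; hence
the comparison of inverses. -/
theorem faithfulSMul (hf : Function.Injective h.rep) (I : Set B) :
    letI := h.polyAction (parabolic cs I)
    FaithfulSMul (parabolic cs I) h.polyRing := by
  let := h.polyAction (parabolic cs I)
  refine ⟨fun {g g'} hg => Subtype.ext (inv_injective (hf (LinearMap.ext fun v => ?_)))⟩
  rw [← sub_eq_zero, ← Module.forall_dual_apply_eq_zero_iff ℂ]
  intro f
  have h1 := (h.act_ι g f).symm.trans ((hg _).trans (h.act_ι g' f))
  have h2 := LinearMap.congr_fun (SymmetricAlgebra.ι_injective h1) v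
  simp only [Representation.dual_apply, Module.Dual.transpose_apply, LinearMap.comp_apply] at h2
  rw [map_sub, h2, sub_self]

theorem mem_polyGrading_two_mul {k : ℕ} {x : h.polyRing}
    (hx : x ∈ SymmetricAlgebra.grading ℂ (Module.Dual ℂ V) k) : x ∈ h.polyGrading (2 * k) :=
  Submodule.mem_iSup_of_mem k (Submodule.mem_iSup_of_mem rfl hx)

theorem polyGrading_cases {i : ℤ} {x : h.polyRing} (hx : x ∈ h.polyGrading i) :
    x = 0 ∨ ∃ k : ℕ, i = 2 * k ∧ x ∈ SymmetricAlgebra.grading ℂ (Module.Dual ℂ V) k := by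
  by_cases hi : ∃ k : ℕ, i = 2 * k
  · obtain ⟨k, rfl⟩ := hi
    refine Or.inr ⟨k, rfl, ?_⟩
    have : h.polyGrading (2 * k) ≤ SymmetricAlgebra.grading ℂ (Module.Dual ℂ V) k :=
      iSup₂_le fun j hj => by rw [show k = j by omega]
    exact this hx
  · left
    have : h.polyGrading i ≤ ⊥ := iSup₂_le fun j hj => absurd ⟨j, hj⟩ hi
    exact (Submodule.mem_bot ℂ).1 (this hx)

theorem one_mem_polyGrading : (1 : h.polyRing) ∈ h.polyGrading 0 :=
  h.mem_polyGrading_two_mul (k := 0) SetLike.GradedOne.one_mem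

theorem mul_mem_polyGrading {i j : ℤ} {x y : h.polyRing} (hx : x ∈ h.polyGrading i)
    (hy : y ∈ h.polyGrading j) : x * y ∈ h.polyGrading (i + j) := by
  obtain rfl | ⟨k, rfl, hx'⟩ := h.polyGrading_cases hx
  · simp
  obtain rfl | ⟨l, rfl, hy'⟩ := h.polyGrading_cases hy
  · simp
  rw [← mul_add, ← Nat.cast_add]
  exact h.mem_polyGrading_two_mul (SetLike.mul_mem_graded hx' hy')

/-- The ring `R` is a graded free Frobenius extension of `R^I` of rank `|W_I|`, with form a
composite of Demazure operators. -/
theorem exists_frobenius (hf : Function.Injective h.rep) (I : Set B)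
    [Finite (parabolic cs I)] :
    ∃ (D : I → Module.End (h.invariants (parabolic cs I)) h.polyRing) (w : List I)
      (b : Module.Basis (Fin (Nat.card (parabolic cs I))) (h.invariants (parabolic cs I)) h.polyRing)
      (b' : Fin (Nat.card (parabolic cs I)) → h.polyRing)
      (deg : Fin (Nat.card (parabolic cs I)) → ℤ),
      (∀ s : I, ∀ a ∈ h.invariants {cs.simple s}, ∀ x, D s (a * x) = a * D s x) ∧
      (∀ (s : I) x, D s x ∈ h.invariants {cs.simple s}) ∧
      (∀ (s : I) i, ∀ x ∈ h.polyGrading i, D s x ∈ h.polyGrading (i - 2)) ∧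
      (∀ k, b k ∈ h.polyGrading (deg k)) ∧
      (∀ k, b' k ∈ h.polyGrading (2 * w.length - deg k)) ∧
      (∀ x, (w.map D).prod x ∈ h.invariants (parabolic cs I)) ∧
      ∀ i k, (w.map D).prod (b i * b' k) = if i = k then 1 else 0 := by
  let := h.polyAction (parabolic cs I)
  have := h.faithfulSMul hf I
  let H := h.reflectionAction I
  obtain ⟨w, b, b', deg, hb, hdeg, hb', hA, hbb'⟩ := H.exists_frobenius
  refine ⟨H.demazure, w, b, b', fun k => 2 * deg k, ?_, ?_, ?_, ?_, ?_, hA, hbb'⟩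
  · exact fun s a ha x => H.demazure_mul_of_smul_eq s (ha _ rfl) x
  · rintro s x _ rfl
    exact H.refl_smul_demazure s x
  · intro s i x hxi
    obtain rfl | ⟨k, rfl, hx⟩ := h.polyGrading_cases hxi
    · simp
    clear hxi
    -- In degree 0 the target degree is -2, where only 0 lives; the operator kills constants.
    rcases k with _ | k
    · rw [H.demazure_deg_zero s hx]; exact zero_mem _
    · rw [show 2 * ((k + 1 : ℕ) : ℤ) - 2 = 2 * (k : ℕ) by push_cast; ring]
      exact h.mem_polyGrading_two_mul (H.demazure_mem s hx)
  · exact fun k => h.mem_polyGrading_two_mul (hb k)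
  · intro k
    rw [← mul_sub, ← Nat.cast_sub (hdeg k)]
    exact h.mem_polyGrading_two_mul (hb' k)

end Realization
end

noncomputable section

/-! ### Splitting an idempotent endomorphism off a matrix object -/

/-- Idempotency of e is a consequence: inserting ∑ a_j b_j = 1 gives a_i e = a_i, hence b_0 a_0 e =
b_0 a_0. The a_i and b_i are then the projections and inclusions of a biproduct in the Karoubi
completion. -/
theorem CategoryTheory.Idempotents.exists_iso_biproduct {D : Type*} [Category D] [Preadditive D]
    {P Q : D} {n : ℕ} [NeZero n] (a : Fin n → (P ⟶ Q)) (b : Fin n → (Q ⟶ P)) {e : Q ⟶ Q}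
    (hba : ∀ i j, b i ≫ a j = if i = j then e else 0) (hab : ∑ i, a i ≫ b i = 𝟙 P) :
    ∃ (he : e ≫ e = e) (_ : HasBiproduct fun _ : Fin n => (⟨Q, e, he⟩ : Idempotents.Karoubi D)),
      Nonempty ((Idempotents.toKaroubi D).obj P ≅
        ⨁ fun _ : Fin n => (⟨Q, e, he⟩ : Idempotents.Karoubi D)) := by
  have hae : ∀ i, a i ≫ e = a i := fun i => by
    have h := congrArg (· ≫ a i) hab
    simpa [Preadditive.sum_comp, hba, apply_ite] using h
  have heb : ∀ i, e ≫ b i = b i := fun i => by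
    have h := congrArg (b i ≫ ·) hab
    simpa [Preadditive.comp_sum, ← Category.assoc, hba, ite_comp] using h
  have he : e ≫ e = e := by
    -- Here n ≠ 0 matters: with no indices, nothing would constrain e.
    have h : e = b 0 ≫ a 0 := by simp [hba]
    conv_rhs => rw [h, ← hae]
    rw [← Category.assoc, ← h]
  let π (i : Fin n) : (Idempotents.toKaroubi D).obj P ⟶ (⟨Q, e, he⟩ : Idempotents.Karoubi D) :=
    { f := a i
      comm := by simp [hae] }
  let ι (i : Fin n) : (⟨Q, e, he⟩ : Idempotents.Karoubi D) ⟶ (Idempotents.toKaroubi D).obj P :=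
    { f := b i
      comm := by simp [heb] }
  let c : Limits.Bicone fun _ : Fin n => (⟨Q, e, he⟩ : Idempotents.Karoubi D) :=
    { pt := (Idempotents.toKaroubi D).obj P
      π := π
      ι := ι
      ι_π := fun i j => by
        ext
        by_cases h : i = j
        · subst h
          simp [ι, π, hba]
        · simp [ι, π, hba, h] }
  have hc : c.IsBilimit := isBilimitOfTotal c (by
    ext
    simpa [c, ι, π] using hab)
  have hbi := HasBiproduct.mk ⟨c, hc⟩
  exact ⟨he, hbi, ⟨biproduct.uniqueUpToIso _ hc⟩⟩

/-! ### The horizontal trace of a matrix-like object -/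

/-- Data on an object `X` of a monoidal category which identify `X ⊗ X` with a sum of copies of `X`
compatibly with the outer actions, as for `X = R ⊗_A R` with `R` free over `A`. -/
structure MatrixObject {C : Type*} [Category C] [MonoidalCategory C] [Preadditive C] (X : C)
    (n : ℕ) where
  /-- the inclusions of the summands -/
  ins : Fin n → (X ⟶ X ⊗ X)
  /-- the projections to the summands -/
  proj : Fin n → (X ⊗ X ⟶ X)
  /-- the counit -/
  counit : X ⟶ 𝟙_ C
  /-- the comultiplication -/
  comul : X ⟶ X ⊗ X
  ins_proj : ∀ i j, ins i ≫ proj j = if i = j then 𝟙 X else 0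
  sum_proj_ins : ∑ i, proj i ≫ ins i = 𝟙 (X ⊗ X)
  -- In the model, inserting b_i in one slot commutes with contracting another one, because the
  -- coordinates lie in A and cross every ⊗_A.
  ins_whiskerRight : ∀ i j, ins i ▷ X ≫ (α_ X X X).hom ≫ X ◁ proj j = proj j ≫ ins i
  whiskerLeft_ins : ∀ i j, X ◁ ins i ≫ (α_ X X X).inv ≫ proj j ▷ X = proj j ≫ ins i
  comul_counit : comul ≫ counit ▷ X = (λ_ X).inv
  -- In the model the right-hand side is x ⊗ y ⊗ z ↦ x ⊗ 1 ⊗ y z. The left-hand side expands y in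
  -- the basis b, carrying coordinates and basis vectors separately.
  sum_whiskerLeft : ∑ j, X ◁ (ins j ≫ X ◁ counit ≫ (ρ_ X).hom ≫ comul) ≫ (α_ X X X).inv ≫
    proj j ▷ X = X ◁ counit ≫ (ρ_ X).hom ≫ comul

namespace Tr0

universe v u
variable {C : Type u} [Category.{v} C] [MonoidalCategory C] [Preadditive C] [Linear ℂ C]
  [MonoidalPreadditive C] [MonoidalLinear ℂ C]

/-- The class of a map as a morphism in the horizontal trace. -/
def clsHom (X X' Y : C) : (X ⊗ Y ⟶ Y ⊗ X') →ₗ[ℂ] (of X ⟶ of X') := cls X X' Y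

theorem clsHom_comp {X X' X'' Y Y' : C} (g : X ⊗ Y ⟶ Y ⊗ X') (f : X' ⊗ Y' ⟶ Y' ⊗ X'') :
    clsHom X X' Y g ≫ clsHom X' X'' Y' f = clsHom X X'' (Y ⊗ Y')
      ((α_ X Y Y').inv ≫ g ▷ Y' ≫ (α_ Y X' Y').hom ≫ Y ◁ f ≫ (α_ Y Y' X'').inv) :=
  comp_cls X X' X'' Y Y' g f

theorem clsHom_rel {X X' Y Y' : C} (c : Y ⟶ Y') (f : X ⊗ Y' ⟶ Y ⊗ X') :
    clsHom X X' Y' (f ≫ c ▷ X') = clsHom X X' Y (X ◁ c ≫ f) := cls_rel c f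

theorem id_eq_clsHom (X : C) : 𝟙 (of X) = clsHom X X (𝟙_ C) ((ρ_ X).hom ≫ (λ_ X).inv) := rfl

end Tr0

theorem HH0.equivEnd_cls' {C : Type*} [Category C] [MonoidalCategory C] [Preadditive C] [Linear ℂ C]
    [MonoidalPreadditive C] [MonoidalLinear ℂ C] (X : C) (f : X ⟶ X) :
    HH0.equivEnd C (HH0.cls X f) = Tr0.clsHom (𝟙_ C) (𝟙_ C) X ((λ_ X).hom ≫ f ≫ (ρ_ X).inv) :=
  HH0.equivEnd_cls C X f

namespace MatrixObject

open Tr0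

universe v u
variable {C : Type u} [Category.{v} C] [MonoidalCategory C] [Preadditive C] [Linear ℂ C]
  [MonoidalPreadditive C] [MonoidalLinear ℂ C] {X : C} {n : ℕ} (T : MatrixObject X n)

/-- The projections `Tr₀(X) ⟶ Tr₀(𝟙)`. -/
def trProj (i : Fin n) : of X ⟶ of (𝟙_ C) := clsHom X (𝟙_ C) X (T.proj i ≫ (ρ_ X).inv)

/-- The inclusions `Tr₀(𝟙) ⟶ Tr₀(X)`. -/
def trIns (i : Fin n) : of (𝟙_ C) ⟶ of X := clsHom (𝟙_ C) X X ((λ_ X).hom ≫ T.ins i)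

/-- The composite is represented on X ⊗ X by `proj j` followed by `ins i`; cyclicity of HH₀ reverses
the order and leaves δ_ij Id_X. -/
theorem trIns_trProj (i j : Fin n) :
    T.trIns i ≫ T.trProj j = if i = j then HH0.equivEnd C (HH0.cls X (𝟙 X)) else 0 := by
  have h1 : T.trIns i ≫ T.trProj j = HH0.equivEnd C (HH0.cls (X ⊗ X) (T.proj j ≫ T.ins i)) := by
    rw [trIns, trProj, clsHom_comp, HH0.equivEnd_cls']
    congr 1
    simp [← T.ins_whiskerRight]
  rw [h1, HH0.cls_comm, T.ins_proj]
  split_ifs <;> simp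

/-- Morphisms of the trace computed through `X ⊗ X` can be computed through `X`. -/
theorem clsHom_eq_sum {Z Z' : C} (f : Z ⊗ (X ⊗ X) ⟶ (X ⊗ X) ⊗ Z') :
    clsHom Z Z' (X ⊗ X) f = ∑ j, clsHom Z Z' X (Z ◁ T.ins j ≫ f ≫ T.proj j ▷ Z') := by
  have h1 : f = ∑ j, (f ≫ T.proj j ▷ Z') ≫ T.ins j ▷ Z' := by
    simp_rw [Category.assoc, ← comp_whiskerRight, ← Preadditive.comp_sum, ← sum_whiskerRight,
      T.sum_proj_ins, id_whiskerRight, Category.comp_id]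
  conv_lhs => rw [h1, map_sum]
  exact Finset.sum_congr rfl fun j _ => clsHom_rel _ _

/-- Sliding the counit around replaces the auxiliary object X by 𝟙 and produces the canonical
representative of the identity. This second representative is the tool for `clsHom_id`. -/
theorem clsHom_counit_comul :
    clsHom X X X (X ◁ T.counit ≫ (ρ_ X).hom ≫ T.comul) = 𝟙 (of X) := by
  rw [← clsHom_rel, Category.assoc, T.comul_counit, id_eq_clsHom]

include T in
-- Compose with the identity in the form given by `clsHom_counit_comul`. Reduced from X ⊗ X to X,
-- the composite is the same representative again, so [Id] ≫ 1 = 1.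
theorem clsHom_id : clsHom X X X (𝟙 (X ⊗ X)) = 𝟙 (of X) := by
  have h1 : clsHom X X X (𝟙 (X ⊗ X)) ≫ clsHom X X X (X ◁ T.counit ≫ (ρ_ X).hom ≫ T.comul) =
      𝟙 (of X) := by
    rw [clsHom_comp, T.clsHom_eq_sum, ← T.clsHom_counit_comul, ← map_sum]
    congr 1
    refine Eq.trans ?_ T.sum_whiskerLeft
    simp
  rwa [T.clsHom_counit_comul, Category.comp_id] at h1

/-- Reduced through X, the i-th composite becomes a sum over j of n terms. Each equals `proj i ≫ ins
i`, because the inner `ins j ≫ proj j` cancels; this produces the factor n. -/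
theorem sum_trProj_trIns : ∑ i, T.trProj i ≫ T.trIns i = (n : ℂ) • 𝟙 (of X) := by
  have h1 : ∀ i, T.trProj i ≫ T.trIns i = (n : ℂ) • clsHom X X X (T.proj i ≫ T.ins i) := by
    intro i
    have h2 : ∀ j, X ◁ T.ins j ≫ ((α_ X X X).inv ≫ (T.proj i ≫ (ρ_ X).inv) ▷ X ≫
        (α_ X (𝟙_ C) X).hom ≫ X ◁ ((λ_ X).hom ≫ T.ins i) ≫ (α_ X X X).inv) ≫ T.proj j ▷ X =
        T.proj i ≫ T.ins i := by
      intro j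
      have h3 : (T.proj i ≫ (ρ_ X).inv) ▷ X ≫ (α_ X (𝟙_ C) X).hom ≫ X ◁ ((λ_ X).hom ≫ T.ins i) =
          T.proj i ▷ X ≫ X ◁ T.ins i := by simp
      simp only [Category.assoc] at h3 ⊢
      have h4 := congrArg (fun f => X ◁ T.ins j ≫ (α_ X X X).inv ≫ f ≫ (α_ X X X).inv ≫
        T.proj j ▷ X) h3
      simp only [Category.assoc] at h4
      rw [h4, reassoc_of% T.whiskerLeft_ins j i, T.whiskerLeft_ins i j,
        ← Category.assoc (T.ins j), T.ins_proj, if_pos rfl, Category.id_comp]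
    rw [trProj, trIns, clsHom_comp, T.clsHom_eq_sum]
    simp_rw [h2]
    rw [Finset.sum_const, Finset.card_univ, Fintype.card_fin, Nat.cast_smul_eq_nsmul]
  simp_rw [h1]
  rw [← Finset.smul_sum, ← map_sum, T.sum_proj_ins, T.clsHom_id]

include T in
/-- `Tr₀(X)` is a sum of `n` copies of the image of `[Id_X] / n`. -/
theorem exists_iso_biproduct [NeZero n] :
    ∃ (he : HH0.equivEnd C ((n : ℂ)⁻¹ • HH0.cls X (𝟙 X)) ≫
          HH0.equivEnd C ((n : ℂ)⁻¹ • HH0.cls X (𝟙 X)) =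
        HH0.equivEnd C ((n : ℂ)⁻¹ • HH0.cls X (𝟙 X)))
      (_ : HasBiproduct fun _ : Fin n => (⟨of (𝟙_ C), _, he⟩ : Idempotents.Karoubi (Tr0 C))),
      Nonempty ((Idempotents.toKaroubi (Tr0 C)).obj (of X) ≅
        ⨁ fun _ : Fin n => (⟨of (𝟙_ C), _, he⟩ : Idempotents.Karoubi (Tr0 C))) := by
  refine Idempotents.exists_iso_biproduct (fun i => (n : ℂ)⁻¹ • T.trProj i) T.trIns
    (fun i j => ?_) ?_
  · rw [Linear.comp_smul, T.trIns_trProj]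
    split_ifs <;> simp
  · simp_rw [Linear.smul_comp]
    rw [← Finset.smul_sum, T.sum_trProj_trIns, smul_smul, inv_mul_cancel₀ (NeZero.ne _), one_smul]

end MatrixObject
end

noncomputable section
universe u

namespace GrBimod

variable {R : Type u} [CommRing R] [Algebra ℂ R] {𝒜 : ℤ → Submodule ℂ R}

/-! ### Maps out of `R ⊗_A R` -/

variable (𝒜) in
/-- The element `x ⊗ y` of `R ⊗_A R`. -/
def bsMk (A : Subalgebra ℂ R) : R →ₗ[ℂ] R →ₗ[ℂ] (bs 𝒜 A).carrier :=
  LinearMap.mk₂ ℂ (fun x y => x ⊗ₜ[A] y) (fun _ _ _ => TensorProduct.add_tmul _ _ _)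
    (fun _ _ _ => rfl) (fun _ _ _ => TensorProduct.tmul_add _ _ _)
    (fun _ _ _ => TensorProduct.tmul_smul _ _ _)

variable {A : Subalgebra ℂ R}

@[simp] theorem bs_left (a x y : R) : (bs 𝒜 A).left a (bsMk 𝒜 A x y) = bsMk 𝒜 A (a * x) y := by
  change (a ⊗ₜ[A] (1 : R)) * (x ⊗ₜ[A] y) = (a * x) ⊗ₜ[A] y
  rw [Algebra.TensorProduct.tmul_mul_tmul, one_mul]

@[simp] theorem bs_right (a x y : R) : (bs 𝒜 A).right a (bsMk 𝒜 A x y) = bsMk 𝒜 A x (a * y) := by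
  change ((1 : R) ⊗ₜ[A] a) * (x ⊗ₜ[A] y) = x ⊗ₜ[A] (a * y)
  rw [Algebra.TensorProduct.tmul_mul_tmul, one_mul]

theorem bsMk_mul_of_mem {a : R} (ha : a ∈ A) (x y : R) :
    bsMk 𝒜 A (a * x) y = bsMk 𝒜 A x (a * y) :=
  TensorProduct.smul_tmul (⟨a, ha⟩ : A) x y

theorem bs_induction {p : (bs 𝒜 A).carrier → Prop} (zero : p 0) (mk : ∀ x y, p (bsMk 𝒜 A x y))
    (add : ∀ m n, p m → p n → p (m + n)) (m : (bs 𝒜 A).carrier) : p m :=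
  TensorProduct.induction_on (motive := p) m zero mk add

theorem bs_lin_ext {P : Type*} [AddCommGroup P] [Module ℂ P] {f g : (bs 𝒜 A).carrier →ₗ[ℂ] P}
    (h : ∀ x y, f (bsMk 𝒜 A x y) = g (bsMk 𝒜 A x y)) : f = g :=
  LinearMap.ext fun m => bs_induction (p := fun m => f m = g m) (by simp) h
    (fun m n hm hn => by rw [map_add, map_add, hm, hn]) m

/-- The universal property of `R ⊗_A R`. -/
def bsDesc {P : Type*} [AddCommGroup P] [Module ℂ P] (φ : R →ₗ[ℂ] R →ₗ[ℂ] P)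
    (h : ∀ a ∈ A, ∀ x y, φ (a * x) y = φ x (a * y)) : (bs 𝒜 A).carrier →ₗ[ℂ] P :=
  let F : (bs 𝒜 A).carrier →+ P := TensorProduct.liftAddHom (R := A) (M := R) (N := R)
    (AddMonoidHom.mk' (fun x => (φ x).toAddMonoidHom) fun x y => by ext; simp)
    fun a x y => h a a.2 x y
  { toFun := F
    map_add' := F.map_add
    map_smul' := fun c m => bs_induction (𝒜 := 𝒜) (A := A)
      (p := fun m => F (c • m) = c • F m) (by simp)
      (fun x y => (congrArg (fun f : R →ₗ[ℂ] P => f y) (φ.map_smul c x)))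
      (fun m n hm hn => by rw [smul_add, F.map_add, hm, hn, F.map_add, smul_add]) m }

@[simp] theorem bsDesc_mk {P : Type*} [AddCommGroup P] [Module ℂ P] (φ : R →ₗ[ℂ] R →ₗ[ℂ] P)
    (h : ∀ a ∈ A, ∀ x y, φ (a * x) y = φ x (a * y)) (x y : R) :
    bsDesc (𝒜 := 𝒜) φ h (bsMk 𝒜 A x y) = φ x y := rfl

theorem left_mul (N : GrBimod 𝒜) (a b : R) (n : N.carrier) :
    N.left (a * b) n = N.left a (N.left b n) := by rw [map_mul]; rfl

theorem right_mul (N : GrBimod 𝒜) (a b : R) (n : N.carrier) :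
    N.right (a * b) n = N.right a (N.right b n) := by rw [map_mul]; rfl

/-- The bimodule map out of `R ⊗_A R` given by an element on which the actions of `A` agree. -/
def bsHom {N : GrBimod 𝒜} (n : N.carrier) (hn : ∀ a ∈ A, N.left a n = N.right a n) :
    bs 𝒜 A ⟶ N :=
  let f : (bs 𝒜 A).carrier →ₗ[ℂ] N.carrier :=
    bsDesc (LinearMap.mk₂ ℂ (fun x y => N.left x (N.right y n))
      (fun _ _ _ => by simp) (fun _ _ _ => by simp) (fun _ _ _ => by simp) (fun _ _ _ => by simp))
      (fun a ha x y => by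
        simp only [LinearMap.mk₂_apply]
        rw [mul_comm, left_mul, N.left_right, hn a ha, mul_comm a, right_mul])
  have hf : ∀ x y, f (bsMk 𝒜 A x y) = N.left x (N.right y n) := fun x y => by simp [f]
  Hom.mk f
    (fun a => LinearMap.congr_fun (f := f ∘ₗ (bs 𝒜 A).left a) (g := N.left a ∘ₗ f)
      (bs_lin_ext fun x y => by simp [hf]))
    (fun a => LinearMap.congr_fun (f := f ∘ₗ (bs 𝒜 A).right a) (g := N.right a ∘ₗ f)
      (bs_lin_ext fun x y => by simp [hf, N.left_right]))

@[simp] theorem bsHom_mk {N : GrBimod 𝒜} (n : N.carrier) (hn : ∀ a ∈ A, N.left a n = N.right a n)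
    (x y : R) : Hom.lin (bsHom n hn) (bsMk 𝒜 A x y) = N.left x (N.right y n) := by
  simp [bsHom]

theorem bs_hom_ext {N : GrBimod 𝒜} {f g : bs 𝒜 A ⟶ N}
    (h : Hom.lin f (bsMk 𝒜 A 1 1) = Hom.lin g (bsMk 𝒜 A 1 1)) : f = g :=
  hom_ext (bs_lin_ext fun x y => by
    have e : bsMk 𝒜 A x y = (bs 𝒜 A).left x ((bs 𝒜 A).right y (bsMk 𝒜 A 1 1)) := by simp
    rw [e, lin_left, lin_left, lin_right, lin_right, h])

/-- The bimodule map `(x ⊗ y) ⊗ n ↦ x ψ(y n)`. -/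
def bsTensorHom {N P : GrBimod 𝒜} (ψ : N.carrier →ₗ[ℂ] P.carrier)
    (hl : ∀ a ∈ A, ∀ n, ψ (N.left a n) = P.left a (ψ n))
    (hr : ∀ a n, ψ (N.right a n) = P.right a (ψ n)) : tensor (bs 𝒜 A) N ⟶ P :=
  let φ : (bs 𝒜 A).carrier →ₗ[ℂ] N.carrier →ₗ[ℂ] P.carrier :=
    bsDesc (LinearMap.mk₂ ℂ (fun x y => P.left x ∘ₗ ψ ∘ₗ N.left y)
      (fun _ _ _ => by ext; simp) (fun _ _ _ => by ext; simp) (fun _ _ _ => by ext; simp)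
      (fun _ _ _ => by ext; simp))
      (fun a ha x y => LinearMap.ext fun n => by
        simp only [LinearMap.mk₂_apply, LinearMap.comp_apply]
        rw [mul_comm, left_mul, left_mul, hl a ha])
  have hφ : ∀ x y n, φ (bsMk 𝒜 A x y) n = P.left x (ψ (N.left y n)) := fun x y n => by simp [φ]
  Hom.mkT (lift φ fun r m n => bs_induction
      (p := fun m => φ ((bs 𝒜 A).right r m) n = φ m (N.left r n)) (by simp)
      (fun x y => by rw [bs_right, hφ, hφ, mul_comm, left_mul])
      (fun m m' h h' => by simp only [map_add, LinearMap.add_apply, h, h']) m)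
    (fun a m n => by
      rw [lift_tmul, lift_tmul]
      exact bs_induction (p := fun m => φ ((bs 𝒜 A).left a m) n = P.left a (φ m n)) (by simp)
        (fun x y => by rw [bs_left, hφ, hφ, left_mul])
        (fun m m' h h' => by simp only [map_add, LinearMap.add_apply, h, h']) m)
    (fun a m n => by
      rw [lift_tmul, lift_tmul]
      exact bs_induction (p := fun m => φ m (N.right a n) = P.right a (φ m n)) (by simp)
        (fun x y => by rw [hφ, hφ, N.left_right, hr, P.left_right])
        (fun m m' h h' => by simp only [map_add, LinearMap.add_apply, h, h']) m)

@[simp] theorem bsTensorHom_tmul {N P : GrBimod 𝒜} (ψ : N.carrier →ₗ[ℂ] P.carrier)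
    (hl : ∀ a ∈ A, ∀ n, ψ (N.left a n) = P.left a (ψ n))
    (hr : ∀ a n, ψ (N.right a n) = P.right a (ψ n)) (x y : R) (n : N.carrier) :
    Hom.lin (bsTensorHom ψ hl hr) (tmul (bs 𝒜 A) N (bsMk 𝒜 A x y) n) =
      P.left x (ψ (N.left y n)) := by
  simp [bsTensorHom]

/-- The elements 1 ⊗ y ⊗ 1 generate R ⊗_A R ⊗_A R as a bimodule. -/
theorem bs_hom_ext₂ {N : GrBimod 𝒜} {f g : tensor (bs 𝒜 A) (bs 𝒜 A) ⟶ N}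
    (h : ∀ y, Hom.lin f (tmul (bs 𝒜 A) (bs 𝒜 A) (bsMk 𝒜 A 1 1) (bsMk 𝒜 A y 1)) =
      Hom.lin g (tmul (bs 𝒜 A) (bs 𝒜 A) (bsMk 𝒜 A 1 1) (bsMk 𝒜 A y 1))) : f = g := by
  have e : ∀ x y z w, tmul (bs 𝒜 A) (bs 𝒜 A) (bsMk 𝒜 A x y) (bsMk 𝒜 A z w) =
      (tensor (bs 𝒜 A) (bs 𝒜 A)).left x ((tensor (bs 𝒜 A) (bs 𝒜 A)).right w
        (tmul (bs 𝒜 A) (bs 𝒜 A) (bsMk 𝒜 A 1 1) (bsMk 𝒜 A (y * z) 1))) := fun x y z w => by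
    have h1 : bsMk 𝒜 A x y = (bs 𝒜 A).right y (bsMk 𝒜 A x 1) := by simp
    rw [h1, tmul_rel]
    simp
  refine hom_ext₂ fun m n => ?_
  refine bs_induction (p := fun m => Hom.lin f (tmul (bs 𝒜 A) (bs 𝒜 A) m n) =
    Hom.lin g (tmul (bs 𝒜 A) (bs 𝒜 A) m n)) (by simp) (fun x y => ?_)
    (fun m m' h h' => by simp only [map_add, LinearMap.add_apply, h, h']) m
  refine bs_induction (p := fun n => Hom.lin f (tmul (bs 𝒜 A) (bs 𝒜 A) (bsMk 𝒜 A x y) n) =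
    Hom.lin g (tmul (bs 𝒜 A) (bs 𝒜 A) (bsMk 𝒜 A x y) n)) (by simp) (fun z w => ?_)
    (fun m m' h h' => by simp only [map_add, h, h']) n
  rw [e, lin_left, lin_left, lin_right, lin_right, h]

/-! ### `R ⊗_A R` as a matrix object -/

theorem lin_sum {M N : GrBimod 𝒜} {ι : Type*} (s : Finset ι) (f : ι → (M ⟶ N)) (m : M.carrier) :
    Hom.lin (∑ i ∈ s, f i) m = ∑ i ∈ s, Hom.lin (f i) m := by
  classical
  induction s using Finset.induction_on with
  | empty => rfl
  | insert i s hi ih => rw [Finset.sum_insert hi, Finset.sum_insert hi, ← ih]; rfl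

variable (𝒜) in
/-- The insertion `x ⊗ y ↦ x ⊗ r ⊗ y`. -/
def bsInsert (A : Subalgebra ℂ R) (r : R) : bs 𝒜 A ⟶ tensor (bs 𝒜 A) (bs 𝒜 A) :=
  bsHom (tmul (bs 𝒜 A) (bs 𝒜 A) (bsMk 𝒜 A 1 r) (bsMk 𝒜 A 1 1)) fun a ha => by
    have h1 : bsMk 𝒜 A 1 (a * r) = (bs 𝒜 A).right a (bsMk 𝒜 A 1 r) := by simp
    rw [left_tmul, bs_left, bsMk_mul_of_mem ha, h1, tmul_rel, bs_left, bsMk_mul_of_mem ha,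
      right_tmul, bs_right]

@[simp] theorem bsInsert_mk (r x y : R) : Hom.lin (bsInsert 𝒜 A r) (bsMk 𝒜 A x y) =
    tmul (bs 𝒜 A) (bs 𝒜 A) (bsMk 𝒜 A x r) (bsMk 𝒜 A 1 y) := by
  simp [bsInsert]

variable (𝒜) in
/-- The multiplication `x ⊗ y ↦ x y`. -/
def bsCounit (A : Subalgebra ℂ R) : bs 𝒜 A ⟶ unit 𝒜 := bsHom (one 𝒜) fun _ _ => rfl

@[simp] theorem bsCounit_mk (x y : R) : Hom.lin (bsCounit 𝒜 A) (bsMk 𝒜 A x y) =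
    (unit 𝒜).left x ((unit 𝒜).right y (one 𝒜)) := bsHom_mk _ _ x y

theorem coe_map_mul_of_mem (c : R →ₗ[A] A) {a : R} (ha : a ∈ A) (x : R) :
    (c (a * x) : R) = a * c x :=
  congrArg Subtype.val (c.map_smul ⟨a, ha⟩ x)

variable (𝒜) in
/-- The map `x ⊗ y ↦ λ(x) ⊗ y` for a functional `λ` with values in `A`. -/
def bsApply (c : R →ₗ[A] A) : (bs 𝒜 A).carrier →ₗ[ℂ] (bs 𝒜 A).carrier :=
  bsDesc ((bsMk 𝒜 A) ∘ₗ A.val.toLinearMap ∘ₗ c.restrictScalars ℂ) fun a ha x y => by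
    simp [coe_map_mul_of_mem c ha, bsMk_mul_of_mem ha]

@[simp] theorem bsApply_mk (c : R →ₗ[A] A) (x y : R) :
    bsApply 𝒜 c (bsMk 𝒜 A x y) = bsMk 𝒜 A (c x) y := rfl

variable (𝒜) in
/-- The map `x ⊗ y ⊗ z ↦ x λ(y) ⊗ z` for a functional `λ` with values in `A`. -/
def bsContract (c : R →ₗ[A] A) : tensor (bs 𝒜 A) (bs 𝒜 A) ⟶ bs 𝒜 A :=
  bsTensorHom (bsApply 𝒜 c)
    (fun a ha => LinearMap.congr_fun (f := bsApply 𝒜 c ∘ₗ (bs 𝒜 A).left a)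
      (g := (bs 𝒜 A).left a ∘ₗ bsApply 𝒜 c)
      (bs_lin_ext fun x y => by simp [coe_map_mul_of_mem c ha]))
    (fun a => LinearMap.congr_fun (f := bsApply 𝒜 c ∘ₗ (bs 𝒜 A).right a)
      (g := (bs 𝒜 A).right a ∘ₗ bsApply 𝒜 c) (bs_lin_ext fun x y => by simp))

@[simp] theorem bsContract_tmul (c : R →ₗ[A] A) (x y z w : R) :
    Hom.lin (bsContract 𝒜 c) (tmul (bs 𝒜 A) (bs 𝒜 A) (bsMk 𝒜 A x y) (bsMk 𝒜 A z w)) =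
      bsMk 𝒜 A (x * c (y * z)) w := by
  simp [bsContract]

theorem tmul_mul_of_mem {a : R} (ha : a ∈ A) (x y z w : R) :
    tmul (bs 𝒜 A) (bs 𝒜 A) (bsMk 𝒜 A (a * x) y) (bsMk 𝒜 A z w) =
      tmul (bs 𝒜 A) (bs 𝒜 A) (bsMk 𝒜 A x y) (bsMk 𝒜 A (a * z) w) := by
  rw [bsMk_mul_of_mem ha, ← bs_right, tmul_rel, bs_left]

variable (𝒜) in
/-- The bimodule `R ⊗_A R` is a matrix object if `R` is free over `A`. -/
def bsMatrixObject {n : ℕ} (b : Module.Basis (Fin n) A R) : MatrixObject (bs 𝒜 A) n where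
  ins i := bsInsert 𝒜 A (b i)
  proj i := bsContract 𝒜 (b.coord i)
  counit := bsCounit 𝒜 A
  comul := bsInsert 𝒜 A 1
  ins_proj i j := bs_hom_ext (by
    rw [lin_comp, LinearMap.comp_apply, bsInsert_mk, bsContract_tmul]
    split_ifs with h
    · subst h; simp
    · simp [h]; rfl)
  sum_proj_ins := bs_hom_ext₂ fun y => by
    refine (lin_sum _ _ _).trans ?_
    have h1 : ∀ i, Hom.lin (bsContract 𝒜 (b.coord i) ≫ bsInsert 𝒜 A (b i))
        (tmul (bs 𝒜 A) (bs 𝒜 A) (bsMk 𝒜 A 1 1) (bsMk 𝒜 A y 1)) =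
          tmul (bs 𝒜 A) (bs 𝒜 A) (bsMk 𝒜 A 1 (b.repr y i * b i)) (bsMk 𝒜 A 1 1) := by
      intro i
      simp [← bsMk_mul_of_mem]
    have h2 : ∑ i, (b.repr y i : R) * b i = y := b.sum_repr y
    refine (Finset.sum_congr rfl fun i _ => h1 i).trans ?_
    rw [← LinearMap.sum_apply, ← map_sum, ← map_sum, h2]
    have h3 : bsMk 𝒜 A 1 y = (bs 𝒜 A).right y (bsMk 𝒜 A 1 1) := by simp
    rw [h3, tmul_rel, bs_left, mul_one]
    rfl
  ins_whiskerRight i j := bs_hom_ext₂ fun y => by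
    change Hom.lin (mapHom (bsInsert 𝒜 A (b i)) (𝟙 _) ≫ assocHom _ _ _ ≫
      mapHom (𝟙 _) (bsContract 𝒜 (b.coord j))) _ =
        Hom.lin (bsContract 𝒜 (b.coord j) ≫ bsInsert 𝒜 A (b i)) _
    have h := tmul_mul_of_mem (𝒜 := 𝒜) (b.repr y j).2 1 (b i) 1 1
    rw [mul_one] at h
    simpa using h.symm
  whiskerLeft_ins i j := bs_hom_ext₂ fun y => by
    change Hom.lin (mapHom (𝟙 _) (bsInsert 𝒜 A (b i)) ≫ assocInv _ _ _ ≫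
      mapHom (bsContract 𝒜 (b.coord j)) (𝟙 _)) _ =
        Hom.lin (bsContract 𝒜 (b.coord j) ≫ bsInsert 𝒜 A (b i)) _
    simp
  comul_counit := bs_hom_ext (by
    change Hom.lin (bsInsert 𝒜 A 1 ≫ mapHom (bsCounit 𝒜 A) (𝟙 _)) _ = Hom.lin (unitLInv _) _
    simp)
  sum_whiskerLeft := bs_hom_ext₂ fun y => by
    refine (lin_sum _ _ _).trans ?_
    have h1 : ∀ j, Hom.lin (mapHom (𝟙 (bs 𝒜 A)) (bsInsert 𝒜 A (b j) ≫
        mapHom (𝟙 (bs 𝒜 A)) (bsCounit 𝒜 A) ≫ unitR _ ≫ bsInsert 𝒜 A 1) ≫ assocInv _ _ _ ≫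
        mapHom (bsContract 𝒜 (b.coord j)) (𝟙 _))
          (tmul (bs 𝒜 A) (bs 𝒜 A) (bsMk 𝒜 A 1 1) (bsMk 𝒜 A y 1)) =
        tmul (bs 𝒜 A) (bs 𝒜 A) (bsMk 𝒜 A 1 1) (bsMk 𝒜 A 1 (b.repr y j * b j)) := by
      intro j
      have h := tmul_mul_of_mem (𝒜 := 𝒜) (b.repr y j).2 1 1 1 (b j)
      rw [bsMk_mul_of_mem (b.repr y j).2 1 (b j), mul_one] at h
      simpa using h
    have h2 : ∑ i, (b.repr y i : R) * b i = y := b.sum_repr y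
    refine (Finset.sum_congr rfl fun i _ => h1 i).trans ?_
    rw [← map_sum, ← map_sum, h2]
    change _ = Hom.lin (mapHom (𝟙 (bs 𝒜 A)) (bsCounit 𝒜 A) ≫ unitR _ ≫ bsInsert 𝒜 A 1) _
    have h3 : actR (bs 𝒜 A) ((unit 𝒜).left y (one 𝒜)) (bsMk 𝒜 A 1 1) = bsMk 𝒜 A 1 y := by
      change (bs 𝒜 A).right (y * 1) _ = _
      simp
    simp [h3]

end GrBimod
end

noncomputable section
universe u

namespace GrBimod

variable {R : Type u} [CommRing R] [Algebra ℂ R] {𝒜 : ℤ → Submodule ℂ R}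

/-! ### The bimodule of `A`-linear endomorphisms of `R` -/

variable (𝒜) in
/-- The bimodule `End_A(R)`. -/
def endBimod (A : Subalgebra ℂ R) : GrBimod 𝒜 where
  carrier := R →ₗ[A] R
  left := AlgHom.ofLinearMap
    { toFun := fun a =>
        { toFun := fun T => LinearMap.mulLeft A a ∘ₗ T
          map_add' := fun _ _ => LinearMap.comp_add _ _ _
          map_smul' := fun _ _ => LinearMap.comp_smul _ _ _ }
      map_add' := fun a b => by ext T x; exact add_mul a b (T x)
      map_smul' := fun c a => by ext T x; exact smul_mul_assoc c a (T x) }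
    (by ext T x; exact one_mul (T x)) (fun a b => by ext T x; exact mul_assoc a b (T x))
  right := AlgHom.ofLinearMap
    { toFun := fun a =>
        { toFun := fun T => T ∘ₗ LinearMap.mulLeft A a
          map_add' := fun S T => LinearMap.add_comp _ _ _
          map_smul' := fun c T => LinearMap.smul_comp _ _ _ }
      map_add' := fun a b => by
        ext T x; exact (congrArg T (add_mul a b x)).trans (T.map_add _ _)
      map_smul' := fun c a => by
        ext T x; exact (congrArg T (smul_mul_assoc c a x)).trans (T.map_smul_of_tower c _) }
    (by ext T x; exact congrArg T (one_mul x))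
    (fun a b => by ext T x; exact congrArg T ((mul_comm a b ▸ mul_assoc b a x)))
  left_right a b T := rfl
  gr i :=
    { carrier := {T | ∀ j, ∀ x ∈ 𝒜 j, T x ∈ 𝒜 (j + i)}
      zero_mem' := fun _ _ _ => zero_mem _
      add_mem' := fun hS hT j x hx => add_mem (hS j x hx) (hT j x hx)
      smul_mem' := fun c _ hT j x hx => Submodule.smul_mem _ c (hT j x hx) }

variable {A : Subalgebra ℂ R}

variable (𝒜) in
/-- An `A`-linear endomorphism of `R` as an element of the bimodule. -/
def endMk (T : R →ₗ[A] R) : (endBimod 𝒜 A).carrier := T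

/-- The value of an element of `End_A(R)`. -/
def endVal (T : (endBimod 𝒜 A).carrier) : R →ₗ[A] R := T

@[simp] theorem endVal_left (a : R) (T : (endBimod 𝒜 A).carrier) (x : R) :
    endVal ((endBimod 𝒜 A).left a T) x = a * endVal T x := rfl
@[simp] theorem endVal_right (a : R) (T : (endBimod 𝒜 A).carrier) (x : R) :
    endVal ((endBimod 𝒜 A).right a T) x = endVal T (a * x) := rfl
theorem end_ext {S T : (endBimod 𝒜 A).carrier} (h : ∀ x, endVal S x = endVal T x) : S = T :=
  LinearMap.ext h

variable (𝒜) in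
/-- The map `R ⟶ End_A(R)`. -/
def unitToEnd (A : Subalgebra ℂ R) : unit 𝒜 ⟶ endBimod 𝒜 A :=
  Hom.mk (M := unit 𝒜)
    { toFun := fun a => endMk 𝒜 (LinearMap.mulLeft A (@id R a))
      map_add' := fun a b => end_ext fun x => add_mul (@id R a) b x
      map_smul' := fun c a => end_ext fun x => smul_mul_assoc c (@id R a) x }
    (fun a m => end_ext fun x => mul_assoc a (@id R m) x)
    (fun a m => end_ext fun x => (congrArg (· * x) (mul_comm a (@id R m))).trans (mul_assoc _ _ _))

variable (𝒜) in
/-- Postcomposition with an endomorphism of `R`. -/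
def endComp (D : R →ₗ[A] R) : (endBimod 𝒜 A).carrier →ₗ[ℂ] (endBimod 𝒜 A).carrier where
  toFun T := endMk 𝒜 (D ∘ₗ endVal T)
  map_add' _ _ := LinearMap.comp_add _ _ _
  map_smul' _ _ := LinearMap.comp_smul _ _ _

variable (𝒜) in
/-- The map `(x ⊗ y) ⊗ T ↦ x D y T` for a `C`-linear endomorphism `D` of `R`. -/
def bsToEnd {C : Subalgebra ℂ R} (D : R →ₗ[A] R) (hD : ∀ a ∈ C, ∀ x, D (a * x) = a * D x) :
    tensor (bs 𝒜 C) (endBimod 𝒜 A) ⟶ endBimod 𝒜 A :=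
  bsTensorHom (N := endBimod 𝒜 A) (P := endBimod 𝒜 A) (endComp 𝒜 D)
    (fun a ha T => end_ext fun x => hD a ha (endVal T x)) (fun _ _ => end_ext fun _ => rfl)

theorem bsToEnd_tmul {C : Subalgebra ℂ R} (D : R →ₗ[A] R)
    (hD : ∀ a ∈ C, ∀ x, D (a * x) = a * D x) (x y : R) (T : (endBimod 𝒜 A).carrier) (z : R) :
    endVal (Hom.lin (bsToEnd 𝒜 D hD) (tmul (bs 𝒜 C) (endBimod 𝒜 A) (bsMk 𝒜 C x y) T)) z =
      x * D (y * endVal T z) := by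
  have h := bsTensorHom_tmul (N := endBimod 𝒜 A) (P := endBimod 𝒜 A) (endComp 𝒜 D)
    (fun a ha T => end_ext fun x => hD a ha (endVal T x)) (fun _ _ => end_ext fun _ => rfl) x y T
  exact congrArg (fun S => endVal S z) h

/-! ### Dual bases and the map End_A(R) → R ⊗_A R. -/

section dualBasis

variable {n : ℕ} {F : R →ₗ[A] R} (hF : ∀ x, F x ∈ A) {b : Module.Basis (Fin n) A R}
  {b' : Fin n → R} (hb : ∀ i k, F (b i * b' k) = if i = k then 1 else 0)

include hb in
theorem sum_mul_basis (x : R) : ∑ k, F (x * b' k) * b k = x := by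
  have h1 : ∀ k, F (x * b' k) = b.repr x k := fun k => by
    conv_lhs => rw [← b.sum_repr x, Finset.sum_mul, map_sum]
    simp_rw [smul_mul_assoc, map_smul, hb, smul_ite, smul_zero]
    rw [Finset.sum_ite_eq' Finset.univ k, if_pos (Finset.mem_univ k), Subalgebra.smul_def,
      smul_eq_mul, mul_one]
  simp_rw [h1]
  exact b.sum_repr x

include hF hb in
-- The difference of the two sides pairs to 0 with every b_j, hence with every element of R, and
-- `sum_mul_basis` then shows that it vanishes.
theorem sum_mul_dual (x : R) : ∑ k, F (x * b k) * b' k = x := by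
  have hmul : ∀ a ∈ A, ∀ y, F (a * y) = a * F y := fun a ha y => F.map_smul ⟨a, ha⟩ y
  have h1 : ∀ j, F ((x - ∑ k, F (x * b k) * b' k) * b j) = 0 := fun j => by
    rw [sub_mul, Finset.sum_mul, map_sub, map_sum]
    have h2 : ∀ k, F (F (x * b k) * b' k * b j) = if j = k then F (x * b k) else 0 := fun k => by
      rw [mul_assoc, hmul _ (hF _), mul_comm (b' k), hb, mul_ite, mul_one, mul_zero]
    simp [h2]
  rw [eq_comm, ← sub_eq_zero, ← sum_mul_basis hb (x - _)]
  refine Finset.sum_eq_zero fun k _ => ?_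
  rw [← b.sum_repr (b' k), Finset.mul_sum, map_sum, Finset.sum_eq_zero, zero_mul]
  intro i _
  rw [mul_smul_comm, map_smul, h1, smul_zero]

variable (𝒜) in
/-- The map `End_A(R) ⟶ R ⊗_A R` given by dual bases. -/
def endToBs : endBimod 𝒜 A ⟶ bs 𝒜 A :=
  Hom.mk (M := endBimod 𝒜 A)
    { toFun := fun T => ∑ k, bsMk 𝒜 A (endVal T (b k)) (b' k)
      map_add' := fun S T => by
        rw [← Finset.sum_add_distrib]
        refine Finset.sum_congr rfl fun k _ => ?_
        rw [← LinearMap.add_apply, ← map_add]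
        rfl
      map_smul' := fun c T => by
        rw [RingHom.id_apply, Finset.smul_sum]
        refine Finset.sum_congr rfl fun k _ => ?_
        rw [← LinearMap.smul_apply, ← map_smul]
        rfl }
    (fun a T => by simp)
    (fun a T => by
      -- Right linearity: expand a b_k in the basis b, move the coefficients F(a b_k b'_j) ∈ A
      -- across ⊗_A, and resum over k as the expansion of a b'_j in the dual basis.
      have hT : ∀ k, endVal T (a * b k) = ∑ j, F (a * b k * b' j) * endVal T (b j) := fun k => by
        conv_lhs => rw [← sum_mul_basis hb (a * b k), map_sum]
        exact Finset.sum_congr rfl fun j _ => (endVal T).map_smul ⟨_, hF _⟩ (b j)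
      have h1 : ∀ k j, bsMk 𝒜 A (F (a * b k * b' j) * endVal T (b j)) (b' k) =
          bsMk 𝒜 A (endVal T (b j)) (F (a * b' j * b k) * b' k) := fun k j => by
        rw [bsMk_mul_of_mem (hF _), mul_right_comm]
      simp only [LinearMap.coe_mk, AddHom.coe_mk, endVal_right, map_sum, bs_right, hT,
        LinearMap.sum_apply, h1]
      rw [Finset.sum_comm]
      refine Finset.sum_congr rfl fun j _ => ?_
      rw [← map_sum, sum_mul_dual hF hb])

end dualBasis

/-! ### `R ⊗_A R` as a summand of a Bott–Samelson bimodule -/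

section word

variable {ι : Type*} (C : ι → Subalgebra ℂ R)

variable (𝒜) in
/-- The Bott–Samelson bimodule of a word. -/
def bsWord : List ι → GrBimod 𝒜
  | [] => unit 𝒜
  | s :: w => tensor ((bs 𝒜 (C s)).shift 1) (bsWord w)

variable (𝒜) in
/-- The generator `1 ⊗ ⋯ ⊗ 1`. -/
def bsWordOne : (w : List ι) → (bsWord 𝒜 C w).carrier
  | [] => one 𝒜
  | s :: w => tmul ((bs 𝒜 (C s)).shift 1) (bsWord 𝒜 C w) (bsMk 𝒜 (C s) 1 1) (bsWordOne w)

/-- Elements of A lie in every C s, so they cross every tensor sign. This is what makes 1 ⊗ 1 ↦ 1 ⊗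
⋯ ⊗ 1 a bimodule map out of R ⊗_A R. -/
theorem bsWordOne_comm (hC : ∀ s, A ≤ C s) (w : List ι) {a : R} (ha : a ∈ A) :
    (bsWord 𝒜 C w).left a (bsWordOne 𝒜 C w) = (bsWord 𝒜 C w).right a (bsWordOne 𝒜 C w) := by
  induction w with
  | nil => rfl
  | cons s w ih =>
    have h1 : ((bs 𝒜 (C s)).shift 1).left a (bsMk 𝒜 (C s) 1 1) =
        ((bs 𝒜 (C s)).shift 1).right a (bsMk 𝒜 (C s) 1 1) :=
      (bs_left a 1 1).trans ((bsMk_mul_of_mem (hC s ha) 1 1).trans (bs_right a 1 1).symm)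
    refine (left_tmul _ _ _ _ _).trans ?_
    rw [h1]
    refine (tmul_rel _ _ _).trans ?_
    rw [ih]
    exact (right_tmul _ _ _ _ _).symm

/-- The identification `M(n) ≅ M`, forgetting degrees. -/
def shiftHom (M : GrBimod 𝒜) (n : ℤ) : M.shift n ⟶ M :=
  Hom.mk (M := M.shift n) LinearMap.id (fun _ _ => rfl) (fun _ _ => rfl)

/-- The identification `M ≅ M(n)`, forgetting degrees. -/
def shiftInv (M : GrBimod 𝒜) (n : ℤ) : M ⟶ M.shift n :=
  Hom.mk (N := M.shift n) LinearMap.id (fun _ _ => rfl) (fun _ _ => rfl)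

variable (D : ι → Module.End A R) (hD : ∀ s, ∀ a ∈ C s, ∀ x, D s (a * x) = a * D s x)

variable (𝒜) in
/-- The map `x₀ ⊗ ⋯ ⊗ xₗ ↦ x₀ D₁ x₁ ⋯ Dₗ xₗ` from a Bott–Samelson bimodule to `End_A(R)`. -/
def bsWordToEnd : (w : List ι) → (bsWord 𝒜 C w ⟶ endBimod 𝒜 A)
  | [] => unitToEnd 𝒜 A
  | s :: w => mapHom (shiftHom _ 1) (bsWordToEnd w) ≫ bsToEnd 𝒜 (D s) (hD s)

theorem bsWordToEnd_cons (s : ι) (w : List ι) (x y : R) (m : (bsWord 𝒜 C w).carrier) (z : R) :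
    endVal (Hom.lin (bsWordToEnd 𝒜 C D hD (s :: w))
      (tmul ((bs 𝒜 (C s)).shift 1) (bsWord 𝒜 C w) (bsMk 𝒜 (C s) x y) m)) z =
      x * D s (y * endVal (Hom.lin (bsWordToEnd 𝒜 C D hD w) m) z) := by
  refine Eq.trans ?_ (bsToEnd_tmul (D s) (hD s) x y (Hom.lin (bsWordToEnd 𝒜 C D hD w) m) z)
  exact congr(endVal (Hom.lin (bsToEnd 𝒜 (D s) (hD s))
    $(mapHom_tmul (shiftHom (bs 𝒜 (C s)) 1) (bsWordToEnd 𝒜 C D hD w) (bsMk 𝒜 (C s) x y) m)) z)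

theorem bsWordToEnd_one (w : List ι) (x : R) :
    endVal (Hom.lin (bsWordToEnd 𝒜 C D hD w) (bsWordOne 𝒜 C w)) x = (w.map D).prod x := by
  induction w with
  | nil => exact one_mul x
  | cons s w ih =>
    refine (bsWordToEnd_cons C D hD s w 1 1 _ x).trans ?_
    rw [one_mul, one_mul, ih]
    simp

variable (h1 : (1 : R) ∈ 𝒜 0) (hmul : ∀ {i j : ℤ} {x y : R}, x ∈ 𝒜 i → y ∈ 𝒜 j → x * y ∈ 𝒜 (i + j))

theorem tmul_mem_gr {M N : GrBimod 𝒜} {i j k : ℤ} {m : M.carrier} {n : N.carrier}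
    (hm : m ∈ M.gr i) (hn : n ∈ N.gr j) (hk : i + j = k) : tmul M N m n ∈ (M.tensor N).gr k := by
  have h := Submodule.subset_span (R := ℂ) (s := {x | ∃ j l, j + l = k ∧ ∃ m ∈ M.gr j, ∃ n ∈ N.gr l,
    x = preMk M N m n}) ⟨i, j, hk, m, hm, n, hn, rfl⟩
  exact h

theorem tensor_gr_le {M N : GrBimod 𝒜} {i : ℤ} {S : Submodule ℂ (M.tensor N).carrier}
    (h : ∀ j k, j + k = i → ∀ m ∈ M.gr j, ∀ n ∈ N.gr k, tmul M N m n ∈ S) :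
    (M.tensor N).gr i ≤ S := by
  refine Submodule.span_le.2 ?_
  rintro _ ⟨j, k, hjk, m, hm, n, hn, rfl⟩
  exact h j k hjk m hm n hn

theorem bsMk_mem_gr {B : Subalgebra ℂ R} {i j k : ℤ} {x y : R} (hx : x ∈ 𝒜 i) (hy : y ∈ 𝒜 j)
    (hk : i + j = k) : bsMk 𝒜 B x y ∈ (bs 𝒜 B).gr k := by
  have h := Submodule.subset_span (R := ℂ) (s := {z | ∃ j l, j + l = k ∧ ∃ a ∈ 𝒜 j, ∃ b ∈ 𝒜 l,
    z = a ⊗ₜ[B] b}) ⟨i, j, hk, x, hx, y, hy, rfl⟩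
  exact h

theorem bs_gr_le {B : Subalgebra ℂ R} {i : ℤ} {S : Submodule ℂ (bs 𝒜 B).carrier}
    (h : ∀ j k, j + k = i → ∀ x ∈ 𝒜 j, ∀ y ∈ 𝒜 k, bsMk 𝒜 B x y ∈ S) : (bs 𝒜 B).gr i ≤ S := by
  refine Submodule.span_le.2 ?_
  rintro _ ⟨j, k, hjk, x, hx, y, hy, rfl⟩
  exact h j k hjk x hx y hy

include h1 in
theorem bsWordOne_mem (w : List ι) : bsWordOne 𝒜 C w ∈ (bsWord 𝒜 C w).gr (-w.length) := by
  induction w with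
  | nil =>
    change (1 : R) ∈ 𝒜 (-(([] : List ι).length : ℤ))
    simpa using h1
  | cons s w ih =>
    have h2 : bsMk 𝒜 (C s) 1 1 ∈ ((bs 𝒜 (C s)).shift 1).gr (-1) :=
      bsMk_mem_gr (k := -1 + 1) h1 h1 rfl
    refine tmul_mem_gr h2 ih ?_
    rw [List.length_cons]
    push_cast
    ring

include hmul in
theorem bsWord_left_mem (w : List ι) {i j : ℤ} {a : R} (ha : a ∈ 𝒜 i)
    {m : (bsWord 𝒜 C w).carrier} (hm : m ∈ (bsWord 𝒜 C w).gr j) :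
    (bsWord 𝒜 C w).left a m ∈ (bsWord 𝒜 C w).gr (i + j) := by
  cases w with
  | nil => exact hmul ha hm
  | cons s w =>
    refine tensor_gr_le (M := (bs 𝒜 (C s)).shift 1) (N := bsWord 𝒜 C w)
      (S := ((bsWord 𝒜 C (s :: w)).gr (i + j)).comap ((bsWord 𝒜 C (s :: w)).left a))
      (fun k l hkl x hx y hy => ?_) hm
    have h2 : (bs 𝒜 (C s)).left a x ∈ (bs 𝒜 (C s)).gr (i + (k + 1)) := by
      refine bs_gr_le (S := ((bs 𝒜 (C s)).gr (i + (k + 1))).comap ((bs 𝒜 (C s)).left a))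
        (fun p q hpq x hx z hz => ?_) hx
      rw [Submodule.mem_comap, bs_left]
      exact bsMk_mem_gr (hmul ha hx) hz (by omega)
    rw [← add_assoc] at h2
    exact (congrArg (· ∈ (bsWord 𝒜 C (s :: w)).gr (i + j))
      (left_tmul ((bs 𝒜 (C s)).shift 1) (bsWord 𝒜 C w) a x y)).mpr
      (tmul_mem_gr (M := (bs 𝒜 (C s)).shift 1) (i := i + k) h2 hy (by omega))

include hmul in
theorem bsWord_right_mem (w : List ι) {i j : ℤ} {a : R} (ha : a ∈ 𝒜 i)
    {m : (bsWord 𝒜 C w).carrier} (hm : m ∈ (bsWord 𝒜 C w).gr j) :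
    (bsWord 𝒜 C w).right a m ∈ (bsWord 𝒜 C w).gr (i + j) := by
  induction w generalizing j with
  | nil => exact hmul ha hm
  | cons s w ih =>
    refine tensor_gr_le (M := (bs 𝒜 (C s)).shift 1) (N := bsWord 𝒜 C w)
      (S := ((bsWord 𝒜 C (s :: w)).gr (i + j)).comap ((bsWord 𝒜 C (s :: w)).right a))
      (fun k l hkl x hx y hy => ?_) hm
    exact (congrArg (· ∈ (bsWord 𝒜 C (s :: w)).gr (i + j))
      (right_tmul ((bs 𝒜 (C s)).shift 1) (bsWord 𝒜 C w) a x y)).mpr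
      (tmul_mem_gr (M := (bs 𝒜 (C s)).shift 1) hx (ih hy) (by omega))

include hmul in
-- Each letter lowers the degree by one: D s contributes -2, and the shift of its tensor factor
-- gives back 1.
theorem bsWordToEnd_mem (hdeg : ∀ s i, ∀ x ∈ 𝒜 i, D s x ∈ 𝒜 (i - 2)) (w : List ι) {i : ℤ}
    {m : (bsWord 𝒜 C w).carrier} (hm : m ∈ (bsWord 𝒜 C w).gr i) :
    Hom.lin (bsWordToEnd 𝒜 C D hD w) m ∈ (endBimod 𝒜 A).gr (i - w.length) := by
  induction w generalizing i with
  | nil =>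
    intro j x hx
    have h := hmul hm hx
    change @id R m * x ∈ 𝒜 (j + (i - (([] : List ι).length : ℤ)))
    rw [List.length_nil, Nat.cast_zero, sub_zero, add_comm]
    exact h
  | cons s w ih =>
    refine tensor_gr_le (M := (bs 𝒜 (C s)).shift 1) (N := bsWord 𝒜 C w)
      (S := ((endBimod 𝒜 A).gr (i - (s :: w).length)).comap
        (Hom.lin (bsWordToEnd 𝒜 C D hD (s :: w)))) (fun k l hkl x hx y hy => ?_) hm
    refine bs_gr_le (S := ((endBimod 𝒜 A).gr (i - (s :: w).length)).comap
      (Hom.lin (bsWordToEnd 𝒜 C D hD (s :: w)) ∘ₗ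
        (tmul ((bs 𝒜 (C s)).shift 1) (bsWord 𝒜 C w)).flip y)) (fun p q hpq x hx z hz => ?_) hx
    intro j r hr
    refine (congrArg (· ∈ 𝒜 (j + (i - (s :: w).length)))
      (bsWordToEnd_cons C D hD s w x z y r)).mpr ?_
    have h : x * D s (z * endVal (Hom.lin (bsWordToEnd 𝒜 C D hD w) y) r) ∈ 𝒜 _ :=
      hmul hx (hdeg s _ _ (hmul hz (ih hy j r hr)))
    convert h using 2
    rw [List.length_cons]
    push_cast
    omega

include hD in
/-- If `D₁ ⋯ Dₗ` is a Frobenius form then `R ⊗_A R` is a summand of a Bott–Samelson bimodule. -/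
theorem isSummand_bsWord (hC : ∀ s, A ≤ C s) (h1 : (1 : R) ∈ 𝒜 0)
    (hmul : ∀ {i j : ℤ} {x y : R}, x ∈ 𝒜 i → y ∈ 𝒜 j → x * y ∈ 𝒜 (i + j))
    (hdeg : ∀ s i, ∀ x ∈ 𝒜 i, D s x ∈ 𝒜 (i - 2))
    {n : ℕ} {w : List ι} {b : Module.Basis (Fin n) A R} {b' : Fin n → R} {deg : Fin n → ℤ}
    (hb : ∀ k, b k ∈ 𝒜 (deg k)) (hb' : ∀ k, b' k ∈ 𝒜 (2 * w.length - deg k))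
    (hF : ∀ x, (w.map D).prod x ∈ A)
    (hbb : ∀ i k, (w.map D).prod (b i * b' k) = if i = k then 1 else 0) :
    (bs 𝒜 A).IsSummand ((bsWord 𝒜 C w).shift (-w.length)) := by
  have hc : ∀ a ∈ A, _ := fun a ha => bsWordOne_comm (𝒜 := 𝒜) C hC w ha
  refine ⟨bsHom (bsWordOne 𝒜 C w) hc ≫ shiftInv _ (-w.length),
    shiftHom _ _ ≫ bsWordToEnd 𝒜 C D hD w ≫ endToBs 𝒜 hF hbb, fun i => ?_, fun i m hm => ?_,
    bs_hom_ext ?_⟩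
  · refine bs_gr_le (S := ((bsWord 𝒜 C w).gr (i + -w.length)).comap
      (Hom.lin (bsHom (bsWordOne 𝒜 C w) hc))) fun p q hpq x hx y hy => ?_
    rw [Submodule.mem_comap, bsHom_mk, ← hpq, add_assoc]
    exact bsWord_left_mem C hmul w hx (bsWord_right_mem C hmul w hy (bsWordOne_mem C h1 w))
  · have hm' : m ∈ (bsWord 𝒜 C w).gr (i + -w.length) := hm
    have hT := bsWordToEnd_mem C D hD hmul hdeg w hm'
    change ∑ k, bsMk 𝒜 A (endVal (Hom.lin (bsWordToEnd 𝒜 C D hD w) m) (b k)) (b' k) ∈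
      (bs 𝒜 A).gr i
    refine Submodule.sum_mem _ fun k _ => ?_
    -- With ℓ the length of w, the shift and `bsWordToEnd` each subtract ℓ, so T has degree i - 2ℓ;
    -- the degrees of b_k and b'_k add up to 2ℓ.
    exact bsMk_mem_gr (hT _ _ (hb k)) (hb' k) (by ring)
  · change ∑ k, bsMk 𝒜 A (endVal (Hom.lin (bsWordToEnd 𝒜 C D hD w)
      (Hom.lin (bsHom (bsWordOne 𝒜 C w) hc) (bsMk 𝒜 A 1 1))) (b k)) (b' k) = bsMk 𝒜 A 1 1
    -- The image of 1 ⊗ 1 is ∑ F(b_k) ⊗ b'_k. The values of F lie in A, so it equals 1 ⊗ ∑ F(b_k)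
    -- b'_k, and the sum is the dual-basis expansion of 1.
    have h2 : ∀ k, bsMk 𝒜 A ((w.map D).prod (b k)) (b' k) =
        bsMk 𝒜 A 1 ((w.map D).prod (1 * b k) * b' k) := fun k => by
      rw [one_mul, ← bsMk_mul_of_mem (hF _), mul_one]
    rw [bsHom_mk, map_one, map_one, Module.End.one_apply, Module.End.one_apply]
    simp_rw [bsWordToEnd_one, h2, ← map_sum]
    rw [sum_mul_dual hF hbb]

end word

end GrBimod
end

noncomputable section

/-! ### Soergel bimodules -/

/-- A matrix object lifts to a full monoidal subcategory which contains it. -/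
def MatrixObject.fullSubcategory {C : Type*} [Category C] [MonoidalCategory C] [Preadditive C]
    {P : ObjectProperty C} [P.IsMonoidal] {X : P.FullSubcategory} {n : ℕ}
    (T : MatrixObject X.obj n) : MatrixObject X n where
  ins i := ObjectProperty.homMk (T.ins i)
  proj i := ObjectProperty.homMk (T.proj i)
  counit := ObjectProperty.homMk T.counit
  comul := ObjectProperty.homMk T.comul
  ins_proj i j := by
    have h := T.ins_proj i j
    ext
    refine h.trans ?_
    split_ifs <;> rfl
  sum_proj_ins := by
    ext
    refine Eq.trans ?_ T.sum_proj_ins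
    exact map_sum P.ι.mapAddHom _ _
  ins_whiskerRight i j := ObjectProperty.hom_ext _ (T.ins_whiskerRight i j)
  whiskerLeft_ins i j := ObjectProperty.hom_ext _ (T.whiskerLeft_ins i j)
  comul_counit := ObjectProperty.hom_ext _ T.comul_counit
  sum_whiskerLeft := by
    ext
    refine Eq.trans ?_ T.sum_whiskerLeft
    exact map_sum P.ι.mapAddHom _ _

namespace Realization

universe u
variable {B W : Type*} [Group W] {M : CoxeterMatrix B} {cs : CoxeterSystem M W}
  {V : Type u} [AddCommGroup V] [Module ℂ V]

theorem isSoergel_bsWord (h : Realization cs V) {I : Set B} (w : List I) :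
    h.IsSoergel (GrBimod.bsWord h.polyGrading (fun s : I => h.invariants {cs.simple s}) w) := by
  induction w with
  | nil => exact .unit
  | cons s w ih =>
    have h1 : h.IsSoergel
        ((GrBimod.bs h.polyGrading (h.invariants {cs.simple (s : B)})).shift 1) := by
      have h2 := IsSoergel.simple (h := h) (s : B)
      unfold simpleBimod at h2
      exact h2
    have h3 := IsSoergel.tensor h1 ih
    exact h3

theorem invariants_anti (h : Realization cs V) {H K : Set W} (hHK : H ⊆ K) :
    h.invariants K ≤ h.invariants H :=
  fun _ hf w hw => hf w (hHK hw)

/-- The dual bases of the Demazure form place B_I among the Soergel bimodules; the basis alone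
supplies the matrix structure. -/
theorem exists_matrixObject_genBS (h : Realization cs V) (hf : Function.Injective h.rep)
    (I : Set B) [Finite (parabolic cs I)] :
    ∃ _ : h.IsSoergel (h.genBS I),
      Nonempty (MatrixObject (h.genBS I) (Nat.card (parabolic cs I))) := by
  obtain ⟨D, w, b, b', deg, hlin, -, hdeg, hbdeg, hb'deg, hF, hbb⟩ := h.exists_frobenius hf I
  have hle : ∀ s : I, h.invariants (parabolic cs I) ≤ h.invariants {cs.simple s} :=
    fun s => h.invariants_anti (Set.singleton_subset_iff.2 (Subgroup.subset_closure ⟨s, s.2, rfl⟩))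
  have hsum := GrBimod.isSummand_bsWord _ D hlin hle h.one_mem_polyGrading h.mul_mem_polyGrading
    hdeg hbdeg hb'deg hF hbb
  exact ⟨.summand hsum (.shift _ (h.isSoergel_bsWord w)),
    ⟨GrBimod.bsMatrixObject h.polyGrading b⟩⟩

end Realization

end

set_option maxHeartbeats 1000000 in
theorem mainTheorem10 {B W : Type*} [Finite B] [Group W] {M : CoxeterMatrix B}
    (cs : CoxeterSystem M W) {V : Type*} [AddCommGroup V] [Module ℂ V] [FiniteDimensional ℂ V]
    (h : Realization cs V) (hrf : h.ReflectionFaithful) (hb : h.Balanced)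
    (I : Set B) [Finite (Realization.parabolic cs I)] :
    ∃ hI : h.IsSoergel (h.genBS I),
      let B_I : h.SBim := ⟨h.genBS I, hI⟩
      let n : ℕ := Nat.card (Realization.parabolic cs I)
      let e : Tr0.of (𝟙_ h.SBim) ⟶ Tr0.of (𝟙_ h.SBim) :=
        HH0.equivEnd h.SBim ((n : ℂ)⁻¹ • HH0.cls B_I (𝟙 B_I))
      ∃ (he : e ≫ e = e)
        (_ : HasBiproduct fun _ : Fin n =>
          (⟨Tr0.of (𝟙_ h.SBim), e, he⟩ : Idempotents.Karoubi (Tr0 h.SBim))),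
        Nonempty ((Idempotents.toKaroubi (Tr0 h.SBim)).obj (Tr0.of B_I) ≅
          ⨁ fun _ : Fin n =>
            (⟨Tr0.of (𝟙_ h.SBim), e, he⟩ : Idempotents.Karoubi (Tr0 h.SBim))) := by
  obtain ⟨hI, ⟨T⟩⟩ := h.exists_matrixObject_genBS hrf.1 I
  have : NeZero (Nat.card (Realization.parabolic cs I)) := ⟨Nat.card_pos.ne'⟩
  -- The matrix structure is found on all graded bimodules and must be moved to Soergel bimodules
  -- before taking traces, since the trace depends on which auxiliary objects are allowed.
  exact ⟨hI, (MatrixObject.fullSubcategory (X := (⟨h.genBS I, hI⟩ : h.SBim)) T).exists_iso_biproduct⟩
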